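/- Let $\tau,\rho\in\mathbb R$ with $\tau\neq0$, put $\mu_{n,m}=(-1)^{n+m}\tau$, and let $D\subseteq\mathbb C\setminus\{0\}$ be open and connected. Below, an identity between meromorphic functions on $D$ is understood outside a closed discrete subset of $D$. For a function $u_{n,m}(\alpha,\beta)$ of $(n,m)\in\mathbb Z^2$ and of complex lattice parameters $\alpha,\beta$ with $\alpha-\beta\in D$, call $u$ a *continuously invariant solution* of the discrete potential KdV equation H1 if for every $(n,m)\in\mathbb Z^2$ there is a closed discrete set $P_{n,m}\subset D$ such that, for all $\alpha,\beta$ with $\alpha-\beta\in D\setminus P_{n,m}$, $u_{n,m}$ is differentiable in $\alpha$ and in $\beta$ and $$(u_{n,m}-u_{n+1,m+1})(u_{n+1,m}-u_{n,m+1})-\alpha+\beta=0,$$ $$(u_{n+1,m}-u_{n-1,m})\,\partial_\alpha u_{n,m}+n=0,\qquad (u_{n,m+1}-u_{n,m-1})\,\partial_\beta u_{n,m}+m=0 .$$ Say that meromorphic functions $G,T$ on $D$ form a *Painlevé V pair at $(n,m)$* if $G\not\equiv0,1$, $T\not\equiv0$, $$\frac{d}{dy}\ln T=\mu_{n,m}\,\frac{1+G}{1-G},$$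 and $G$ solves the fifth Painlevé equation $$G''=\Bigl(\frac1{2G}+\frac1{G-1}\Bigr)G'^2-\frac{G'}{y}+\mathfrak a\frac{G(G-1)^2}{y^2}+\mathfrak b\frac{(G-1)^2}{y^2G}+\mathfrak c\frac Gy+\mathfrak d\frac{G(G+1)}{G-1}$$ with $(\mathfrak a,\mathfrak b,\mathfrak c,\mathfrak d)=\bigl(\tfrac{n^2}{2},-\tfrac{m^2}{2},\rho-(-1)^{n+m}\tau,-2\tau^2\bigr)$. Let $(n_0,m_0)\in\mathbb Z^2$ and let $(G_0,T_0)$ be any Painlevé V pair at $(n_0,m_0)$. 1. Suppose $G_0$ satisfies no first-order algebraic differential equation $P(y,G_0,G_0')=0$ with a nonzero polynomial $P$ over $\mathbb C$. Then there are meromorphic functions $G_{n,m},T_{n,m}$ on $D$, $(n,m)\in\mathbb Z^2$, with $G_{n_0,m_0}=G_0$ and $T_{n_0,m_0}=T_0$, such that $(G_{n,m},T_{n,m})$ is a Painlevé V pair at $(n,m)$ for every $(n,m)$ and $$u_{n,m}(\alpha,\beta)=T_{n,m}(\alpha-\beta)\exp\bigl[(-1)^{n+m}\tau(\alpha+\beta)\bigr]$$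 is a continuously invariant solution of H1. 2. Suppose $\rho/\tau$ is not an odd integer (and $G_0$ is arbitrary). Then there are meromorphic $T_{n,m}$ on $D$ and functions $G_{n,m}$ on $D$, with $G_{n_0,m_0}=G_0$ and $T_{n_0,m_0}=T_0$, such that the same $u$ is a continuously invariant solution of H1 on all of $\mathbb Z^2$, and $(G_{n,m},T_{n,m})$ is a Painlevé V pair at every $(n,m)$ for which $n\neq0$ or $n_0=0$, and $m\neq0$ or $m_0=0$. In particular, if $(n_0,m_0)=(0,0)$, this holds at every $(n,m)\in\mathbb Z^2$. -/

import Mathlib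

open Filter

noncomputable section

/-- The exponent `μ = (-1)^(n+m) τ`. -/
def signedTau (τ : ℝ) (n m : ℤ) : ℂ := (-1) ^ (n + m) * (τ : ℂ)

/-- `u` satisfies at the lattice point `(n, m)` and the lattice parameters `(α, β)` the discrete
potential KdV equation H1 and the two invariant surface conditions
`∂u/∂α + n / (u(n+1,m) - u(n-1,m)) = 0` and `∂u/∂β + m / (u(n,m+1) - u(n,m-1)) = 0`,
the latter multiplied by their denominators. For `n ≠ 0` (resp. `m ≠ 0`) the product form forces the
denominator to be nonzero, so that it is the same as the quotient form. -/
structure IsContinuouslyInvariantH1At (u : ℤ → ℤ → ℂ → ℂ → ℂ) (n m : ℤ) (α β : ℂ) : Prop where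
  h1 : (u n m α β - u (n + 1) (m + 1) α β) * (u (n + 1) m α β - u n (m + 1) α β) - α + β = 0
  differentiableAt_fst : DifferentiableAt ℂ (fun a => u n m a β) α
  differentiableAt_snd : DifferentiableAt ℂ (fun b => u n m α b) β
  invariant_fst :
    (u (n + 1) m α β - u (n - 1) m α β) * deriv (fun a => u n m a β) α + (n : ℂ) = 0
  invariant_snd :
    (u n (m + 1) α β - u n (m - 1) α β) * deriv (fun b => u n m α b) β + (m : ℂ) = 0

/-- `u` is a continuously invariant solution of H1 for `α - β ∈ D`: for every lattice point the
equations hold for all `α, β` such that `α - β` lies in `D` outside a closed discrete subset of `D`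
(depending on the lattice point; the functions are allowed to have poles there). -/
def IsContinuouslyInvariantH1Solution (u : ℤ → ℤ → ℂ → ℂ → ℂ) (D : Set ℂ) : Prop :=
  ∀ n m : ℤ, ∀ᶠ y in codiscreteWithin D, ∀ α β : ℂ, α - β = y →
    IsContinuouslyInvariantH1At u n m α β

/-- `G` is a meromorphic solution on `D` of the fifth Painlevé equation with parameters
`a, b, c, d`. -/
def IsPainleveVSolution (a b c d : ℂ) (D : Set ℂ) (G : ℂ → ℂ) : Prop :=
  MeromorphicOn G D ∧ ∀ᶠ y in codiscreteWithin D, G y ≠ 0 ∧ G y ≠ 1 ∧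
    deriv (deriv G) y =
      (1 / (2 * G y) + 1 / (G y - 1)) * (deriv G y) ^ 2 - 1 / y * deriv G y
        + a * (G y * (G y - 1) ^ 2 / y ^ 2) + b * ((G y - 1) ^ 2 / (y ^ 2 * G y))
        + c * (G y / y) + d * (G y * (G y + 1) / (G y - 1))

/-- `T` is a meromorphic function on `D`, not identically zero, with
`d/dy ln T = μ (1 + G) / (1 - G)`. -/
def IsQuadrature (μ : ℂ) (D : Set ℂ) (G T : ℂ → ℂ) : Prop :=
  MeromorphicOn T D ∧ ∀ᶠ y in codiscreteWithin D, T y ≠ 0 ∧ G y ≠ 1 ∧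
    deriv T y / T y = μ * ((1 + G y) / (1 - G y))

/-- The data at a single lattice point `(n, m)`: `G` solves Painlevé V with parameters
`(n²/2, -m²/2, ρ - (-1)^(n+m) τ, -2τ²)`, and `T` is obtained from `G` by the quadrature. -/
def IsPainleveVPair (τ ρ : ℝ) (D : Set ℂ) (n m : ℤ) (G T : ℂ → ℂ) : Prop :=
  IsPainleveVSolution ((n : ℂ) ^ 2 / 2) (-(m : ℂ) ^ 2 / 2) ((ρ : ℂ) - signedTau τ n m)
      (-2 * (τ : ℂ) ^ 2) D G ∧
    IsQuadrature (signedTau τ n m) D G T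

/-- `G` satisfies no algebraic differential equation `P(y, G, G') = 0` of first order
(with a nonzero polynomial `P`) on `D`. -/
def NoFirstOrderAlgebraicODE (D : Set ℂ) (G : ℂ → ℂ) : Prop :=
  ∀ P : MvPolynomial (Fin 3) ℂ,
    (∀ᶠ y in codiscreteWithin D, MvPolynomial.eval ![y, G y, deriv G y] P = 0) → P = 0

/-- The lattice function `u(n,m) = T_{n,m}(α - β) exp[(-1)^(n+m) τ (α + β)]`. -/
def similarityForm (τ : ℝ) (T : ℤ → ℤ → ℂ → ℂ) (n m : ℤ) (α β : ℂ) : ℂ :=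
  T n m (α - β) * Complex.exp (signedTau τ n m * (α + β))

end

/-! ### The similarity reduction of H1 as a differential system. -/

section DifferentialAlgebra

/-! Meromorphic functions on a connected open `D`, identified off closed discrete sets, form a
differential field, so the problem becomes algebraic. Write `P = T' + μT` and `Q = μT - T'`; up to
the exponential factor these are `∂u/∂α` and `∂u/∂β`. A state at `(n, m)` consists of `T` and its
neighbours `a` at `(n+1, m)` and `b` at `(n, m+1)`. It satisfies a first-order system for `a` and
`b` with the integral `aP + bQ = κ`. Under `G = -Q/P` and `z = (a - b)Q` this system is Painlevé V
together with the quadrature (`SimilaritySystem.isAlgebraicPair`,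
`IsAlgebraicPair.exists_similaritySystem`).

The lattice shift in each direction is a product of two involutions. The flip moves to the neighbour
and reverses the direction, using H1 to find the opposite corner. The reflection `n ↦ -n` exchanges
forward and backward neighbours, using the invariant surface condition. Both preserve the system,
and the two shifts commute, so one state generates a solution on all of `ℤ²` (`exists_lattice`).

The moves must never meet a zero denominator (`a_ne_zero`, `reflect_ne_zero`). Each degeneracy makes
`2κ + n + m` an integer, hence `ρ/τ` an odd integer, or else places the scaling invariant quantities
in a field `ℂ(y, e)`. All moves preserve the field generated by these quantities, which contains `y,
G₀, G₀'`. If `G₀` satisfies no first-order algebraic equation, these three are algebraically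
independent, and the second alternative is impossible by transcendence degree.

For Painlevé V at every point one also needs `P ≠ 0` and `Q ≠ 0`. The transcendence argument gives
this in the first case. In the second, `P` can vanish only on the line `n = 0`, where it vanishes
everywhere or nowhere, and likewise `Q` on `m = 0`. -/

theorem charZero_of_algebra_complex (K : Type*) [Field K] [Algebra ℂ K] : CharZero K :=
  charZero_of_injective_algebraMap (algebraMap ℂ K).injective

variable {K : Type*} [Field K] [Algebra ℂ K]

/-- The differential system satisfied by the values `T`, `a`, `b` of a similarity solution of H1 at
`(n, m)`, `(n + 1, m)` and `(n, m + 1)`, together with its first integral. -/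
structure SimilaritySystem (δ : Derivation ℂ K K) (y μ κ n m T a b : K) : Prop where
  fst : y * δ a = -(μ * y * a) + (a - b) * ((a - b) * (μ * T - δ T) - m)
  snd : y * δ b = μ * y * b + (a - b) * ((a - b) * (δ T + μ * T) + n)
  integral : a * (δ T + μ * T) + b * (μ * T - δ T) = κ

namespace SimilaritySystem

variable {δ : Derivation ℂ K K} {y μ κ n m T a b : K}

theorem swap (h : SimilaritySystem δ y μ κ n m T a b) :
    SimilaritySystem (-δ) (-y) μ κ m n T b a := by
  refine ⟨?_, ?_, ?_⟩ <;> simp only [Derivation.coe_neg, Pi.neg_apply]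
  · linear_combination h.snd
  · linear_combination h.fst
  · linear_combination h.integral

theorem deriv_quotient (hy : δ y = 1) {v : K} (hv : v ≠ 0) :
    δ (y / v) = 1 / v - y * δ v / v ^ 2 := by
  rw [Derivation.leibniz_div, hy]
  simp only [smul_eq_mul]
  field_simp

/-- Passing to the lattice point `(n + 1, m)`, seen from the opposite direction. -/
theorem flip (h : SimilaritySystem δ y μ κ n m T a b) (hy : δ y = 1) (hy0 : y ≠ 0)
    (hv : a - b ≠ 0) :
    SimilaritySystem δ y (-μ) (-κ - m) (-n - 1) m a T (T - y / (a - b)) := by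
  obtain ⟨h1, h2, h3⟩ := h
  have hv' : T - (T - y / (a - b)) = y / (a - b) := by ring
  have ha : δ a = (-(μ * y * a) + (a - b) * ((a - b) * (μ * T - δ T) - m)) / y := by
    rw [eq_div_iff hy0, ← h1]; ring
  have hb : δ b = (μ * y * b + (a - b) * ((a - b) * (δ T + μ * T) + n)) / y := by
    rw [eq_div_iff hy0, ← h2]; ring
  refine ⟨?_, ?_, ?_⟩
  · rw [hv', ha]
    field_simp
    ring
  · rw [hv', map_sub, deriv_quotient hy hv, map_sub, ha, hb]
    field_simp
    ring
  · rw [← h3, ha]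
    field_simp
    ring

/-- Differentiate the first integral and eliminate `δ a` and `δ b` by the system; `δ (δ T)` appears
with coefficient `a - b`, which is cancelled. -/
theorem second_order (h : SimilaritySystem δ y μ κ n m T a b) (hμ : δ μ = 0) (hκ : δ κ = 0)
    (hv : a - b ≠ 0) :
    y * δ (δ T) = y * μ ^ 2 * T - 2 * (a - b) * (δ T + μ * T) * (μ * T - δ T)
      - n * (μ * T - δ T) + m * (δ T + μ * T) := by
  obtain ⟨h1, h2, h3⟩ := h
  have h4 := congrArg δ h3
  simp only [map_add, map_sub, Derivation.leibniz, smul_eq_mul, hμ, hκ] at h4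
  apply mul_left_cancel₀ hv
  linear_combination y * h4 - (δ T + μ * T) * h1 - (μ * T - δ T) * h2

/-- The reflection `n ↦ -n`, which replaces the value at `(n + 1, m)` by that at `(n - 1, m)`. -/
theorem reflect (h : SimilaritySystem δ y μ κ n m T a b)
    (hμ : δ μ = 0) (hκ : δ κ = 0) (hn : δ n = 0) (hv : a - b ≠ 0) (hP : δ T + μ * T ≠ 0) :
    SimilaritySystem δ y μ (κ + n) (-n) m T (a + n / (δ T + μ * T)) b := by
  have h4 := h.second_order hμ hκ hv
  obtain ⟨h1, h2, h3⟩ := h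
  refine ⟨?_, ?_, ?_⟩
  · rw [map_add, Derivation.leibniz_div, hn, mul_add, h1]
    simp only [map_add, Derivation.leibniz, smul_eq_mul, hμ]
    field_simp
    -- The derivative of the new term `n / P` involves `δ (δ T)`, which the second-order equation
    -- removes.
    linear_combination (-n) * h4
  · rw [h2]
    field_simp
    ring
  · rw [← h3]
    field_simp
    ring

/-- If `P = 0` then `δ (δ T) = μ² T`, and the second-order equation reduces to `2 μ T n = 0`. Hence
division by `P` in the reflection is harmless: where `P` vanishes, the numerator `n` does too. -/
theorem eq_zero_of_fst_eq_zero (h : SimilaritySystem δ y μ κ n m T a b) (hμ : δ μ = 0)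
    (hμ0 : μ ≠ 0) (hκ : δ κ = 0) (hv : a - b ≠ 0) (hT : T ≠ 0) (hP : δ T + μ * T = 0) : n = 0 := by
  have := charZero_of_algebra_complex K
  have h4 := h.second_order hμ hκ hv
  have h5 := congrArg δ hP
  simp only [map_add, Derivation.leibniz, smul_eq_mul, hμ, map_zero] at h5
  have h6 : 2 * μ * T * n = 0 := by
    linear_combination h4 - y * h5 + (y * μ - 2 * (a - b) * (μ * T - δ T) + n + m) * hP
  simpa [hμ0, hT] using h6

end SimilaritySystem
end DifferentialAlgebra

open IntermediateField (adjoin)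

/-! ### Behaviour of `μ` and of the first integral under the lattice moves. -/

section Parameters

theorem signedTau_neg_fst (τ : ℝ) (n m : ℤ) : signedTau τ (-n) m = signedTau τ n m := by
  unfold signedTau
  rw [show n + m = (-n + m) + (n + n) by ring, zpow_add₀ (a := (-1 : ℂ)) (by norm_num) _ (n + n),
    Even.neg_one_zpow (n := n + n) ⟨n, rfl⟩, mul_one]

theorem signedTau_succ_fst (τ : ℝ) (n m : ℤ) : signedTau τ (n + 1) m = -signedTau τ n m := by
  unfold signedTau
  rw [show n + 1 + m = (n + m) + 1 by ring, zpow_add₀ (by norm_num)]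
  simp

theorem signedTau_comm (τ : ℝ) (n m : ℤ) : signedTau τ n m = signedTau τ m n := by
  simp [signedTau, add_comm]

theorem signedTau_succ_snd (τ : ℝ) (n m : ℤ) : signedTau τ n (m + 1) = -signedTau τ n m := by
  rw [signedTau_comm, signedTau_succ_fst, signedTau_comm]

theorem signedTau_flip_fst (τ : ℝ) (n m : ℤ) : signedTau τ (-n - 1) m = -signedTau τ n m := by
  rw [show -n - 1 = -(n + 1) by ring, signedTau_neg_fst, signedTau_succ_fst]

theorem signedTau_eq_or (τ : ℝ) (n m : ℤ) : signedTau τ n m = τ ∨ signedTau τ n m = -τ := by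
  unfold signedTau
  rcases Int.even_or_odd (n + m) with h | h
  · simp [h.neg_one_zpow]
  · simp [h.neg_one_zpow]

theorem signedTau_ne_zero {τ : ℝ} (hτ : τ ≠ 0) (n m : ℤ) : signedTau τ n m ≠ 0 := by
  rcases signedTau_eq_or τ n m with h | h <;> simp [h, hτ]

theorem signedTau_sq (τ : ℝ) (n m : ℤ) : signedTau τ n m ^ 2 = (τ : ℂ) ^ 2 := by
  rcases signedTau_eq_or τ n m with h | h <;> simp [h]

/-- The value of the first integral `a (T' + μ T) + b (μ T - T')` at `(n, m)`. -/
noncomputable def firstIntegral (τ ρ : ℝ) (n m : ℤ) : ℂ :=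
  (-(ρ / signedTau τ n m + 1) / 2 - n - m) / 2

theorem firstIntegral_comm (τ ρ : ℝ) (n m : ℤ) :
    firstIntegral τ ρ n m = firstIntegral τ ρ m n := by
  rw [firstIntegral, firstIntegral, signedTau_comm]
  ring

theorem firstIntegral_neg_fst (τ ρ : ℝ) (n m : ℤ) :
    firstIntegral τ ρ (-n) m = firstIntegral τ ρ n m + n := by
  rw [firstIntegral, firstIntegral, signedTau_neg_fst]
  push_cast
  ring

theorem firstIntegral_flip_fst (τ ρ : ℝ) (n m : ℤ) :
    firstIntegral τ ρ (-n - 1) m = -firstIntegral τ ρ n m - m := by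
  rw [firstIntegral, firstIntegral, signedTau_flip_fst, div_neg]
  push_cast
  ring

/-- The left side equals `-(ρ/μ + 1)/2` with `μ = ±τ`, so an integer value would make `ρ/τ` an odd
integer. Every resonance is excluded in this form. -/
theorem firstIntegral_ne {τ ρ : ℝ} (hτ : τ ≠ 0) (hρ : ∀ k : ℤ, ρ ≠ (2 * (k : ℝ) + 1) * τ)
    (n m j : ℤ) : 2 * firstIntegral τ ρ n m + n + m ≠ j := by
  intro h
  have hμ := signedTau_ne_zero hτ n m
  have h1 : (ρ : ℂ) = -(2 * j + 1) * signedTau τ n m := by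
    rw [← h, firstIntegral]
    field_simp
    ring
  rcases signedTau_eq_or τ n m with h2 | h2
  rotate_left
  · exact hρ j (by rw [h2, neg_mul_neg] at h1; exact_mod_cast h1)
  · refine hρ (-j - 1) ?_
    rw [h2] at h1
    have h3 : (ρ : ℂ) = (2 * ((-j - 1 : ℤ) : ℂ) + 1) * τ := by
      rw [h1]
      push_cast
      ring
    exact_mod_cast h3

end Parameters

/-! ### Lattice states, the elementary involutions and their nondegeneracy. -/

section LatticeStates

variable {K : Type*} [Field K]

/-- A lattice point `(n, m)` with the values `T`, `a`, `b` at `(n, m)`, `(n + 1, m)`, `(n, m + 1)`. -/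
@[ext]
structure LatticeState (K : Type*) where
  n : ℤ
  m : ℤ
  T : K
  a : K
  b : K

namespace LatticeState

/-- Interchange of the two lattice directions. -/
def swap (σ : LatticeState K) : LatticeState K := ⟨σ.m, σ.n, σ.T, σ.b, σ.a⟩

/-- The lattice point `(n + 1, m)`, seen from the opposite direction. -/
def flipFst (y : K) (σ : LatticeState K) : LatticeState K :=
  ⟨-σ.n - 1, σ.m, σ.a, σ.T, σ.T - y / (σ.a - σ.b)⟩

/-- The lattice point `(n, m + 1)`, seen from the opposite direction. -/
def flipSnd (y : K) (σ : LatticeState K) : LatticeState K :=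
  ⟨σ.n, -σ.m - 1, σ.b, σ.T - y / (σ.a - σ.b), σ.T⟩

theorem flipSnd_eq {y : K} {σ : LatticeState K} : σ.flipSnd y = (σ.swap.flipFst (-y)).swap := by
  ext <;> simp only [swap, flipFst, flipSnd]
  rw [← neg_sub σ.a σ.b, neg_div_neg_eq]

theorem flipFst_flipFst {y : K} {σ : LatticeState K} (hy0 : y ≠ 0) : (σ.flipFst y).flipFst y = σ := by
  ext <;> simp only [flipFst]
  · ring
  · rw [sub_sub_cancel, div_div_cancel₀ hy0]
    ring

theorem flipSnd_flipSnd {y : K} {σ : LatticeState K} (hy0 : y ≠ 0) : (σ.flipSnd y).flipSnd y = σ := by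
  rw [flipSnd_eq, flipSnd_eq]
  exact congrArg swap (flipFst_flipFst (σ := σ.swap) (neg_ne_zero.2 hy0))

theorem flipFst_flipSnd {y : K} {σ : LatticeState K} (hy0 : y ≠ 0) :
    (σ.flipSnd y).flipFst y = (σ.flipFst y).flipSnd y := by
  ext <;> simp only [flipFst, flipSnd, sub_sub_cancel, sub_sub_cancel_left, div_neg, sub_neg_eq_add,
    div_div_cancel₀ hy0]
  all_goals ring

variable [Algebra ℂ K]

/-- The exponent `μ` at a lattice state. -/
noncomputable def mu (τ : ℝ) (σ : LatticeState K) : K := algebraMap ℂ K (signedTau τ σ.n σ.m)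

/-- The reflection `n ↦ -n` at a lattice state. -/
noncomputable def reflectFst (δ : Derivation ℂ K K) (τ : ℝ) (σ : LatticeState K) : LatticeState K :=
  ⟨-σ.n, σ.m, σ.T, σ.a + σ.n / (δ σ.T + σ.mu τ * σ.T), σ.b⟩

/-- The reflection `m ↦ -m` at a lattice state. -/
noncomputable def reflectSnd (δ : Derivation ℂ K K) (τ : ℝ) (σ : LatticeState K) : LatticeState K :=
  ⟨σ.n, -σ.m, σ.T, σ.a, σ.b + σ.m / (σ.mu τ * σ.T - δ σ.T)⟩

/-- The field generated by the scaling invariant quantities of a lattice state. -/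
noncomputable def invariantField (δ : Derivation ℂ K K) (y : K) (σ : LatticeState K) : IntermediateField ℂ K :=
  adjoin ℂ {y, δ σ.T / σ.T, σ.a * σ.T, σ.b * σ.T}

/-- A nondegenerate lattice state satisfying the differential system, whose invariant field
contains the set `S`. -/
structure IsAdmissible (δ : Derivation ℂ K K) (y : K) (τ ρ : ℝ) (S : Set K)
    (σ : LatticeState K) : Prop where
  ne_zero : σ.T ≠ 0
  sub_ne_zero : σ.a - σ.b ≠ 0
  system : SimilaritySystem δ y (σ.mu τ) (algebraMap ℂ K (firstIntegral τ ρ σ.n σ.m)) σ.n σ.m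
    σ.T σ.a σ.b
  subset_field : S ⊆ σ.invariantField δ y

/-- Either `ρ / τ` is not an odd integer, or `S` is not contained in a field generated by `y` and
one more element. -/
def Nonresonant (y : K) (τ ρ : ℝ) (S : Set K) : Prop :=
  (∀ k : ℤ, ρ ≠ (2 * (k : ℝ) + 1) * τ) ∨ ∀ e : K, ¬ S ⊆ adjoin ℂ {y, e}

variable {δ : Derivation ℂ K K} {y : K} {τ ρ : ℝ} {S : Set K} {σ : LatticeState K}

theorem mu_swap : σ.swap.mu τ = σ.mu τ := by
  simp [mu, swap, signedTau_comm]

theorem mu_reflectFst : (σ.reflectFst δ τ).mu τ = σ.mu τ := by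
  simp [mu, reflectFst, signedTau_neg_fst]

theorem mu_flipFst : (σ.flipFst y).mu τ = -σ.mu τ := by
  simp [mu, flipFst, signedTau_flip_fst]

theorem mu_ne_zero (hτ : τ ≠ 0) : σ.mu τ ≠ 0 := by
  simpa [mu] using signedTau_ne_zero hτ σ.n σ.m

theorem map_mu : δ (σ.mu τ) = 0 := δ.map_algebraMap _

theorem reflectSnd_eq : σ.reflectSnd δ τ = (σ.swap.reflectFst (-δ) τ).swap := by
  ext <;> simp only [swap, reflectFst, reflectSnd]
  have : mu τ (⟨σ.m, σ.n, σ.T, σ.b, σ.a⟩ : LatticeState K) = σ.mu τ := mu_swap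
  rw [this]
  congr 2
  simp only [Derivation.coe_neg, Pi.neg_apply]
  ring

theorem reflectFst_reflectFst : (σ.reflectFst δ τ).reflectFst δ τ = σ := by
  ext <;> simp only [reflectFst, neg_neg]
  have : mu τ (⟨-σ.n, σ.m, σ.T, σ.a + σ.n / (δ σ.T + σ.mu τ * σ.T), σ.b⟩ : LatticeState K)
    = σ.mu τ := mu_reflectFst
  rw [this]
  push_cast
  ring

theorem invariantField_swap : σ.swap.invariantField (-δ) (-y) = σ.invariantField δ y := by
  unfold invariantField swap
  apply le_antisymm <;> rw [IntermediateField.adjoin_le_iff] <;>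
    simp only [Set.insert_subset_iff, Set.singleton_subset_iff, Derivation.coe_neg, Pi.neg_apply,
      SetLike.mem_coe, neg_div]
  · refine ⟨neg_mem ?_, neg_mem ?_, ?_, ?_⟩ <;>
      exact IntermediateField.subset_adjoin ℂ _ (by simp)
  · refine ⟨neg_mem_iff.1 ?_, neg_mem_iff.1 ?_, ?_, ?_⟩ <;>
      exact IntermediateField.subset_adjoin ℂ _ (by simp)

theorem IsAdmissible.swap (h : σ.IsAdmissible δ y τ ρ S) :
    σ.swap.IsAdmissible (-δ) (-y) τ ρ S where
  ne_zero := h.ne_zero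
  sub_ne_zero := by
    have := neg_ne_zero.2 h.sub_ne_zero
    rwa [neg_sub] at this
  system := by
    rw [mu_swap]
    have := h.system.swap
    rwa [firstIntegral_comm] at this
  subset_field := by
    rw [invariantField_swap]
    exact h.subset_field

theorem Nonresonant.neg (h : Nonresonant y τ ρ S) : Nonresonant (-y) τ ρ S := by
  refine h.imp id fun h e he => h e (he.trans ?_)
  have : adjoin ℂ {-y, e} ≤ adjoin ℂ {y, e} := by
    rw [IntermediateField.adjoin_le_iff, Set.insert_subset_iff, Set.singleton_subset_iff]
    exact ⟨neg_mem (IntermediateField.subset_adjoin ℂ _ (by simp)),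
      IntermediateField.subset_adjoin ℂ _ (by simp)⟩
  exact this

theorem mem_invariantField :
    y ∈ σ.invariantField δ y ∧ δ σ.T / σ.T ∈ σ.invariantField δ y ∧
      σ.a * σ.T ∈ σ.invariantField δ y ∧ σ.b * σ.T ∈ σ.invariantField δ y := by
  refine ⟨?_, ?_, ?_, ?_⟩ <;> exact IntermediateField.subset_adjoin ℂ _ (by simp)

theorem invariantField_le {F : IntermediateField ℂ K} (h1 : y ∈ F) (h2 : δ σ.T / σ.T ∈ F)
    (h3 : σ.a * σ.T ∈ F) (h4 : σ.b * σ.T ∈ F) : σ.invariantField δ y ≤ F := by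
  rw [invariantField, IntermediateField.adjoin_le_iff]
  simp only [Set.insert_subset_iff, Set.singleton_subset_iff, SetLike.mem_coe]
  exact ⟨h1, h2, h3, h4⟩

theorem mu_mem (F : IntermediateField ℂ K) : σ.mu τ ∈ F := F.algebraMap_mem _

/-- The new logarithmic derivative `δ a / a` is rational in the old invariants by the first equation
of the system. One inclusion suffices, because the flip is an involution. -/
theorem invariantField_flipFst_le (h : σ.IsAdmissible δ y τ ρ S) (hy0 : y ≠ 0) (ha : σ.a ≠ 0) :
    (σ.flipFst y).invariantField δ y ≤ σ.invariantField δ y := by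
  obtain ⟨h1, h2, h3, h4⟩ := mem_invariantField (δ := δ) (y := y) (σ := σ)
  have hT := h.ne_zero
  have hv := h.sub_ne_zero
  refine invariantField_le h1 ?_ ?_ ?_
  · have : δ σ.a / σ.a = -σ.mu τ + (σ.a * σ.T - σ.b * σ.T) *
        ((σ.a * σ.T - σ.b * σ.T) * (σ.mu τ - δ σ.T / σ.T) - σ.m) / (y * (σ.a * σ.T)) := by
      have := h.system.fst
      field_simp
      linear_combination this
    simp only [flipFst]
    rw [this]
    exact add_mem (neg_mem (mu_mem _)) (div_mem (mul_mem (sub_mem h3 h4) (sub_mem (mul_mem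
      (sub_mem h3 h4) (sub_mem (mu_mem _) h2)) (intCast_mem _ _))) (mul_mem h1 h3))
  · simpa only [flipFst, mul_comm] using h3
  · have : (σ.T - y / (σ.a - σ.b)) * σ.a
        = σ.a * σ.T - y * (σ.a * σ.T) / (σ.a * σ.T - σ.b * σ.T) := by
      rw [← sub_mul]
      field_simp
    simp only [flipFst]
    rw [this]
    exact sub_mem h3 (div_mem (mul_mem h1 h3) (sub_mem h3 h4))

theorem invariantField_reflectFst_le (hT : σ.T ≠ 0) :
    (σ.reflectFst δ τ).invariantField δ y ≤ σ.invariantField δ y := by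
  obtain ⟨h1, h2, h3, h4⟩ := mem_invariantField (δ := δ) (y := y) (σ := σ)
  refine invariantField_le h1 h2 ?_ h4
  have : (σ.a + σ.n / (δ σ.T + σ.mu τ * σ.T)) * σ.T = σ.a * σ.T + σ.n / (δ σ.T / σ.T + σ.mu τ) := by
    rw [show δ σ.T / σ.T + σ.mu τ = (δ σ.T + σ.mu τ * σ.T) / σ.T by field_simp, div_div_eq_mul_div]
    ring
  simp only [reflectFst]
  rw [this]
  exact add_mem h3 (div_mem (intCast_mem _ _) (add_mem h2 (mu_mem _)))

theorem Nonresonant.not_le (hres : Nonresonant y τ ρ S) (h : σ.IsAdmissible δ y τ ρ S)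
    (hk : ¬ ∀ k : ℤ, ρ ≠ (2 * (k : ℝ) + 1) * τ) {e : K}
    (h2 : δ σ.T / σ.T ∈ adjoin ℂ {y, e}) (h3 : σ.a * σ.T ∈ adjoin ℂ {y, e})
    (h4 : σ.b * σ.T ∈ adjoin ℂ {y, e}) : False :=
  (hres.resolve_left hk) e (h.subset_field.trans
    (invariantField_le (IntermediateField.subset_adjoin ℂ _ (by simp)) h2 h3 h4))

/-- If `a = 0`, the first equation gives `-bQ = m`, so `κ = -m` and `2κ + n + m` is the integer `n -
m`. In the resonant case the integral expresses `δ T / T` through `bT`, and the invariant field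
collapses to `ℂ(y, bT)`. -/
theorem IsAdmissible.a_ne_zero (h : σ.IsAdmissible δ y τ ρ S) (hτ : τ ≠ 0)
    (hres : Nonresonant y τ ρ S) : σ.a ≠ 0 := by
  intro ha
  have hv := h.sub_ne_zero
  have h1 := h.system.fst
  have h3 := h.system.integral
  have hT := h.ne_zero
  rw [ha] at hv h1 h3
  by_cases hk : ∀ k : ℤ, ρ ≠ (2 * (k : ℝ) + 1) * τ
  · have h4 : (0 - σ.b) * (σ.mu τ * σ.T - δ σ.T) - σ.m = 0 := by
      apply mul_left_cancel₀ hv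
      rw [map_zero] at h1
      linear_combination -h1
    have h5 : algebraMap ℂ K (firstIntegral τ ρ σ.n σ.m) = algebraMap ℂ K (-σ.m) := by
      rw [← h3, map_neg, map_intCast]
      linear_combination -h4
    have h6 := (algebraMap ℂ K).injective h5
    refine firstIntegral_ne hτ hk σ.n σ.m (σ.n - σ.m) ?_
    rw [h6]
    push_cast
    ring
  · have hb : σ.b ≠ 0 := fun hb => hv (by rw [hb, sub_zero])
    have he : σ.b * σ.T ∈ adjoin ℂ {y, σ.b * σ.T} :=
      IntermediateField.subset_adjoin ℂ _ (by simp)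
    refine hres.not_le h hk ?_ ?_ he
    · have : δ σ.T / σ.T
          = σ.mu τ - algebraMap ℂ K (firstIntegral τ ρ σ.n σ.m) / (σ.b * σ.T) := by
        rw [← h3]
        field_simp
        ring
      rw [this]
      exact sub_mem (mu_mem _) (div_mem (IntermediateField.algebraMap_mem _ _) he)
    · rw [ha, zero_mul]
      exact zero_mem _

theorem IsAdmissible.eq_zero_of_fst_eq_zero (h : σ.IsAdmissible δ y τ ρ S) (hτ : τ ≠ 0)
    (hP : δ σ.T + σ.mu τ * σ.T = 0) : σ.n = 0 := by
  have := charZero_of_algebra_complex K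
  have := h.system.eq_zero_of_fst_eq_zero map_mu (mu_ne_zero hτ) (δ.map_algebraMap _)
    h.sub_ne_zero h.ne_zero hP
  exact_mod_cast this

/-- This is the numerator of `a - b` after reflection. If it vanishes, the integral makes `bT` a
constant. The second equation then reads `δ b = μ b`, so `0 = δ (bT) = bP`; hence `b = 0`, `κ = -n`,
a resonance. In the resonant case, `aT` and the constant `bT` lie in `ℂ(y, δ T / T)`. -/
theorem IsAdmissible.reflect_ne_zero (h : σ.IsAdmissible δ y τ ρ S) (hτ : τ ≠ 0)
    (hres : Nonresonant y τ ρ S) (hy0 : y ≠ 0) (hn : σ.n ≠ 0) :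
    (σ.a - σ.b) * (δ σ.T + σ.mu τ * σ.T) + σ.n ≠ 0 := by
  have := charZero_of_algebra_complex K
  intro h0
  have hP : δ σ.T + σ.mu τ * σ.T ≠ 0 := fun hP => hn (h.eq_zero_of_fst_eq_zero hτ hP)
  have hT := h.ne_zero
  have hμ := mu_ne_zero (σ := σ) hτ
  have h3 : 2 * σ.mu τ * (σ.b * σ.T) = algebraMap ℂ K (firstIntegral τ ρ σ.n σ.m) + σ.n := by
    linear_combination h.system.integral - h0
  by_cases hk : ∀ k : ℤ, ρ ≠ (2 * (k : ℝ) + 1) * τ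
  · have h4 : δ σ.b = σ.mu τ * σ.b := by
      apply mul_left_cancel₀ hy0
      linear_combination h.system.snd + (σ.a - σ.b) * h0
    have h5 := congrArg δ h3
    simp only [map_add, Derivation.leibniz, smul_eq_mul, map_mu, δ.map_algebraMap,
      Derivation.map_intCast, h4] at h5
    have h50 : δ (2 : K) = 0 := by
      exact_mod_cast δ.map_natCast 2
    have h6 : 2 * σ.mu τ * (δ σ.T + σ.mu τ * σ.T) * σ.b = 0 := by
      rw [h50] at h5
      linear_combination h5
    have hb : σ.b = 0 := by simpa [hμ, hP] using h6
    have h7 : algebraMap ℂ K (firstIntegral τ ρ σ.n σ.m) = algebraMap ℂ K (-σ.n) := by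
      rw [map_neg, map_intCast]
      rw [hb] at h3
      linear_combination -h3
    have h8 := (algebraMap ℂ K).injective h7
    refine firstIntegral_ne hτ hk σ.n σ.m (σ.m - σ.n) ?_
    rw [h8]
    push_cast
    ring
  · have he : δ σ.T / σ.T ∈ adjoin ℂ {y, δ σ.T / σ.T} :=
      IntermediateField.subset_adjoin ℂ _ (by simp)
    have hb : σ.b * σ.T ∈ adjoin ℂ {y, δ σ.T / σ.T} := by
      have : σ.b * σ.T = (algebraMap ℂ K (firstIntegral τ ρ σ.n σ.m) + σ.n) / (2 * σ.mu τ) := by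
        field_simp
        linear_combination h3
      rw [this]
      exact div_mem (add_mem (IntermediateField.algebraMap_mem _ _) (intCast_mem _ _))
        (mul_mem (ofNat_mem _ 2) (mu_mem _))
    refine hres.not_le h hk he ?_ hb
    have : σ.a * σ.T = σ.b * σ.T - σ.n / (δ σ.T / σ.T + σ.mu τ) := by
      rw [show δ σ.T / σ.T + σ.mu τ = (δ σ.T + σ.mu τ * σ.T) / σ.T by field_simp,
        div_div_eq_mul_div, eq_sub_iff_add_eq, ← eq_sub_iff_add_eq', div_eq_iff hP]
      linear_combination σ.T * h0
    rw [this]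
    exact sub_mem hb (div_mem (intCast_mem _ _) (add_mem he (mu_mem _)))

theorem IsAdmissible.flipFst (h : σ.IsAdmissible δ y τ ρ S) (hτ : τ ≠ 0)
    (hres : Nonresonant y τ ρ S) (hy : δ y = 1) (hy0 : y ≠ 0) :
    (σ.flipFst y).IsAdmissible δ y τ ρ S := by
  have ha := h.a_ne_zero hτ hres
  have hv : (σ.flipFst y).a - (σ.flipFst y).b ≠ 0 := by
    simp only [LatticeState.flipFst, sub_sub_cancel]
    exact div_ne_zero hy0 h.sub_ne_zero
  have hs : SimilaritySystem δ y ((σ.flipFst y).mu τ)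
      (algebraMap ℂ K (firstIntegral τ ρ (σ.flipFst y).n (σ.flipFst y).m)) (σ.flipFst y).n
      (σ.flipFst y).m (σ.flipFst y).T (σ.flipFst y).a (σ.flipFst y).b := by
    have := h.system.flip hy hy0 h.sub_ne_zero
    rw [mu_flipFst]
    simp only [LatticeState.flipFst]
    rwa [firstIntegral_flip_fst, map_sub, map_neg, map_intCast, Int.cast_sub, Int.cast_neg,
      Int.cast_one]
  refine ⟨ha, hv, hs, h.subset_field.trans ?_⟩
  -- The set is `∅` because the inclusion of `S` is still to be shown; it follows by flipping back.
  have h1 : (σ.flipFst y).IsAdmissible δ y τ ρ ∅ := ⟨ha, hv, hs, Set.empty_subset _⟩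
  have h2 := invariantField_flipFst_le h1 hy0 h.ne_zero
  rwa [flipFst_flipFst hy0] at h2

theorem IsAdmissible.reflectFst (h : σ.IsAdmissible δ y τ ρ S) (hτ : τ ≠ 0)
    (hres : Nonresonant y τ ρ S) (hy0 : y ≠ 0) :
    (σ.reflectFst δ τ).IsAdmissible δ y τ ρ S := by
  by_cases hn : σ.n = 0
  · have : σ.reflectFst δ τ = σ := by ext <;> simp [LatticeState.reflectFst, hn]
    rwa [this]
  have hP : δ σ.T + σ.mu τ * σ.T ≠ 0 := fun hP => hn (h.eq_zero_of_fst_eq_zero hτ hP)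
  refine ⟨h.ne_zero, ?_, ?_, h.subset_field.trans ?_⟩
  · have := h.reflect_ne_zero hτ hres hy0 hn
    simp only [LatticeState.reflectFst]
    contrapose! this
    rw [← mul_eq_zero_of_left this (δ σ.T + σ.mu τ * σ.T)]
    field_simp
    ring
  · have := h.system.reflect map_mu (δ.map_algebraMap _) (Derivation.map_intCast δ _)
      h.sub_ne_zero hP
    rw [mu_reflectFst]
    simp only [LatticeState.reflectFst]
    rwa [firstIntegral_neg_fst, map_add, map_intCast, Int.cast_neg]
  · have := invariantField_reflectFst_le (δ := δ) (τ := τ) (y := y) (σ := σ.reflectFst δ τ)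
      h.ne_zero
    rwa [reflectFst_reflectFst] at this

end LatticeState
end LatticeStates


/-! ### Commuting shifts and the solution on the whole lattice. -/

section Lattice

variable {K : Type*} [Field K] [Algebra ℂ K]

namespace LatticeState

variable {δ : Derivation ℂ K K} {y : K} {τ ρ : ℝ} {S : Set K} {σ : LatticeState K}

theorem reflectSnd_reflectSnd : (σ.reflectSnd δ τ).reflectSnd δ τ = σ := by
  rw [reflectSnd_eq, reflectSnd_eq]
  exact congrArg swap (reflectFst_reflectFst (σ := σ.swap))

theorem IsAdmissible.flipSnd (h : σ.IsAdmissible δ y τ ρ S) (hτ : τ ≠ 0)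
    (hres : Nonresonant y τ ρ S) (hy : δ y = 1) (hy0 : y ≠ 0) :
    (σ.flipSnd y).IsAdmissible δ y τ ρ S := by
  have := (h.swap.flipFst hτ hres.neg (by simpa using hy) (neg_ne_zero.2 hy0)).swap
  rwa [neg_neg, neg_neg, ← flipSnd_eq] at this

theorem IsAdmissible.reflectSnd (h : σ.IsAdmissible δ y τ ρ S) (hτ : τ ≠ 0)
    (hres : Nonresonant y τ ρ S) (hy0 : y ≠ 0) :
    (σ.reflectSnd δ τ).IsAdmissible δ y τ ρ S := by
  have := (h.swap.reflectFst hτ hres.neg (neg_ne_zero.2 hy0)).swap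
  rwa [neg_neg, neg_neg, ← reflectSnd_eq] at this

theorem IsAdmissible.eq_zero_of_snd_eq_zero (h : σ.IsAdmissible δ y τ ρ S) (hτ : τ ≠ 0)
    (hQ : σ.mu τ * σ.T - δ σ.T = 0) : σ.m = 0 := by
  refine h.swap.eq_zero_of_fst_eq_zero hτ ?_
  rw [mu_swap, ← hQ]
  simp only [LatticeState.swap, Derivation.coe_neg, Pi.neg_apply]
  ring

theorem IsAdmissible.reflect_snd_ne_zero (h : σ.IsAdmissible δ y τ ρ S) (hτ : τ ≠ 0)
    (hres : Nonresonant y τ ρ S) (hy0 : y ≠ 0) (hm : σ.m ≠ 0) :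
    (σ.a - σ.b) * (σ.mu τ * σ.T - δ σ.T) - σ.m ≠ 0 := by
  have := h.swap.reflect_ne_zero hτ hres.neg (neg_ne_zero.2 hy0) hm
  rw [mu_swap] at this
  contrapose! this
  simp only [LatticeState.swap, Derivation.coe_neg, Pi.neg_apply]
  linear_combination -this

theorem reflectFst_reflectSnd :
    (σ.reflectSnd δ τ).reflectFst δ τ = (σ.reflectFst δ τ).reflectSnd δ τ := by
  have h1 := mu_reflectFst (σ := σ) (δ := δ) (τ := τ)
  have h2 : (σ.reflectSnd δ τ).mu τ = σ.mu τ := by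
    rw [reflectSnd_eq, mu_swap, mu_reflectFst, mu_swap]
  rw [reflectFst, h2, reflectSnd.eq_def _ _ (σ.reflectFst δ τ), h1]
  rfl

/-- Unlike the other commutation rules, those between a flip and the reflection in the other
direction are not formal: here the first equation of the system expresses the new `Q` through the
old one. -/
theorem IsAdmissible.flipFst_reflectSnd (h : σ.IsAdmissible δ y τ ρ S) (hτ : τ ≠ 0)
    (hres : Nonresonant y τ ρ S) (hy0 : y ≠ 0) :
    (σ.reflectSnd δ τ).flipFst y = (σ.flipFst y).reflectSnd δ τ := by
  have h1 := mu_flipFst (σ := σ) (y := y) (τ := τ)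
  rw [LatticeState.reflectSnd.eq_def _ _ (σ.flipFst y), h1]
  ext <;> simp only [LatticeState.flipFst, LatticeState.reflectSnd]
  by_cases hm : σ.m = 0
  · simp [hm]
  have hQ : σ.mu τ * σ.T - δ σ.T ≠ 0 := fun hQ => hm (h.eq_zero_of_snd_eq_zero hτ hQ)
  have hd := h.reflect_snd_ne_zero hτ hres hy0 hm
  have hv := h.sub_ne_zero
  have h2 : -σ.mu τ * σ.a - δ σ.a
      = -((σ.a - σ.b) * ((σ.a - σ.b) * (σ.mu τ * σ.T - δ σ.T) - σ.m)) / y := by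
    rw [eq_div_iff hy0]
    linear_combination -h.system.fst
  have h3 : σ.a - (σ.b + σ.m / (σ.mu τ * σ.T - δ σ.T))
      = ((σ.a - σ.b) * (σ.mu τ * σ.T - δ σ.T) - σ.m) / (σ.mu τ * σ.T - δ σ.T) := by
    field_simp
    ring
  rw [h2, h3]
  -- The nonzero quantity `w` replaces `m` as independent variable, so that every denominator is a
  -- product of known nonzero factors.
  generalize hw : (σ.a - σ.b) * (σ.mu τ * σ.T - δ σ.T) - σ.m = w at hd ⊢
  have h4 : (σ.m : K) = (σ.a - σ.b) * (σ.mu τ * σ.T - δ σ.T) - w := by rw [← hw]; ring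
  rw [h4]
  field_simp
  ring

theorem IsAdmissible.flipSnd_reflectFst (h : σ.IsAdmissible δ y τ ρ S) (hτ : τ ≠ 0)
    (hres : Nonresonant y τ ρ S) (hy0 : y ≠ 0) :
    (σ.reflectFst δ τ).flipSnd y = (σ.flipSnd y).reflectFst δ τ := by
  have h1 := h.swap.flipFst_reflectSnd hτ hres.neg (neg_ne_zero.2 hy0)
  rw [reflectSnd_eq, reflectSnd_eq, neg_neg] at h1
  rw [flipSnd_eq, flipSnd_eq]
  exact congrArg LatticeState.swap h1

/-- An involution of lattice states preserving admissibility, as a permutation. -/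
def admissiblePerm (f : LatticeState K → LatticeState K)
    (hf : ∀ σ : LatticeState K, σ.IsAdmissible δ y τ ρ S → (f σ).IsAdmissible δ y τ ρ S)
    (hinv : ∀ σ : LatticeState K, f (f σ) = σ) :
    Equiv.Perm {σ : LatticeState K // σ.IsAdmissible δ y τ ρ S} :=
  Function.Involutive.toPerm (fun σ => ⟨f σ.1, hf σ.1 σ.2⟩) fun σ => Subtype.ext (hinv σ.1)

/-- Every admissible state extends to a solution on the whole lattice. -/
theorem exists_lattice (hτ : τ ≠ 0) (hres : Nonresonant y τ ρ S) (hy : δ y = 1) (hy0 : y ≠ 0)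
    {σ₀ : LatticeState K} (h₀ : σ₀.IsAdmissible δ y τ ρ S) :
    ∃ σ : ℤ → ℤ → LatticeState K, σ σ₀.n σ₀.m = σ₀ ∧ (∀ n m, (σ n m).IsAdmissible δ y τ ρ S) ∧
      (∀ n m, σ (n + 1) m = ((σ n m).flipFst y).reflectFst δ τ) ∧
      (∀ n m, σ n (m + 1) = ((σ n m).flipSnd y).reflectSnd δ τ) := by
  let A := {σ : LatticeState K // σ.IsAdmissible δ y τ ρ S}
  let f₁ : Equiv.Perm A := admissiblePerm (LatticeState.flipFst y)
    (fun _ h => h.flipFst hτ hres hy hy0) fun _ => flipFst_flipFst hy0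
  let f₂ : Equiv.Perm A := admissiblePerm (LatticeState.flipSnd y)
    (fun _ h => h.flipSnd hτ hres hy hy0) fun _ => flipSnd_flipSnd hy0
  let r₁ : Equiv.Perm A := admissiblePerm (LatticeState.reflectFst δ τ)
    (fun _ h => h.reflectFst hτ hres hy0) fun _ => reflectFst_reflectFst
  let r₂ : Equiv.Perm A := admissiblePerm (LatticeState.reflectSnd δ τ)
    (fun _ h => h.reflectSnd hτ hres hy0) fun _ => reflectSnd_reflectSnd
  have hff : Commute f₁ f₂ := Equiv.ext fun σ => Subtype.ext (flipFst_flipSnd hy0)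
  have hrr : Commute r₁ r₂ := Equiv.ext fun σ => Subtype.ext reflectFst_reflectSnd
  have hfr : Commute f₁ r₂ :=
    Equiv.ext fun σ => Subtype.ext (σ.2.flipFst_reflectSnd hτ hres hy0)
  have hrf : Commute r₁ f₂ :=
    Equiv.ext fun σ => Subtype.ext (σ.2.flipSnd_reflectFst hτ hres hy0).symm
  -- Flip followed by reflection is the unit shift: `n ↦ -n - 1 ↦ n + 1`.
  have hc : Commute (r₁ * f₁) (r₂ * f₂) :=
    (hrr.mul_right hrf).mul_left (hfr.mul_right hff)
  refine ⟨fun n m => (((r₂ * f₂) ^ (m - σ₀.m) * (r₁ * f₁) ^ (n - σ₀.n)) ⟨σ₀, h₀⟩).1, ?_, ?_, ?_, ?_⟩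
  · simp
  · exact fun n m => Subtype.prop _
  · intro n m
    have : (r₂ * f₂) ^ (m - σ₀.m) * (r₁ * f₁) ^ (n + 1 - σ₀.n)
        = (r₁ * f₁) * ((r₂ * f₂) ^ (m - σ₀.m) * (r₁ * f₁) ^ (n - σ₀.n)) := by
      rw [← mul_assoc, (hc.zpow_right _).eq, mul_assoc, ← zpow_one_add]
      congr 2
      ring
    dsimp only
    rw [this]
    rfl
  · intro n m
    have : (r₂ * f₂) ^ (m + 1 - σ₀.m) * (r₁ * f₁) ^ (n - σ₀.n)
        = (r₂ * f₂) * ((r₂ * f₂) ^ (m - σ₀.m) * (r₁ * f₁) ^ (n - σ₀.n)) := by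
      rw [← mul_assoc, ← zpow_one_add]
      congr 2
      ring
    dsimp only
    rw [this]
    rfl

/-- A family of admissible states, one for every lattice point, related by the lattice shifts. -/
structure IsLatticeSolution (δ : Derivation ℂ K K) (y : K) (τ ρ : ℝ) (S : Set K)
    (σ : ℤ → ℤ → LatticeState K) : Prop where
  n_eq : ∀ n m, (σ n m).n = n
  m_eq : ∀ n m, (σ n m).m = m
  admissible : ∀ n m, (σ n m).IsAdmissible δ y τ ρ S
  succ_fst : ∀ n m, σ (n + 1) m = ((σ n m).flipFst y).reflectFst δ τ
  succ_snd : ∀ n m, σ n (m + 1) = ((σ n m).flipSnd y).reflectSnd δ τ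

theorem exists_isLatticeSolution (hτ : τ ≠ 0) (hres : Nonresonant y τ ρ S) (hy : δ y = 1)
    (hy0 : y ≠ 0) {σ₀ : LatticeState K} (h₀ : σ₀.IsAdmissible δ y τ ρ S) :
    ∃ σ : ℤ → ℤ → LatticeState K, σ σ₀.n σ₀.m = σ₀ ∧ IsLatticeSolution δ y τ ρ S σ := by
  obtain ⟨σ, h1, h2, h3, h4⟩ := exists_lattice hτ hres hy hy0 h₀
  have h5 : ∀ n m, (σ (n + 1) m).n = (σ n m).n + 1 ∧ (σ (n + 1) m).m = (σ n m).m := by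
    intro n m
    rw [h3]
    exact ⟨by simp only [reflectFst, flipFst]; ring, rfl⟩
  have h6 : ∀ n m, (σ n (m + 1)).n = (σ n m).n ∧ (σ n (m + 1)).m = (σ n m).m + 1 := by
    intro n m
    rw [h4]
    exact ⟨rfl, by simp only [reflectSnd, flipSnd]; ring⟩
  have h7 : ∀ n, (σ n σ₀.m).n = n ∧ (σ n σ₀.m).m = σ₀.m := by
    intro n
    induction n using Int.inductionOn' (b := σ₀.n) with
    | zero => simp [h1]
    | succ k _ ih => rw [(h5 k _).1, (h5 k _).2, ih.1, ih.2]; simp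
    | pred k _ ih =>
      have := h5 (k - 1) σ₀.m
      rw [sub_add_cancel, ih.1, ih.2] at this
      omega
  have h8 : ∀ n m, (σ n m).n = n ∧ (σ n m).m = m := by
    intro n m
    induction m using Int.inductionOn' (b := σ₀.m) with
    | zero => exact h7 n
    | succ k _ ih => rw [(h6 n k).1, (h6 n k).2, ih.1, ih.2]; simp
    | pred k _ ih =>
      have := h6 n (k - 1)
      rw [sub_add_cancel, ih.1, ih.2] at this
      omega
  exact ⟨σ, h1, fun n m => (h8 n m).1, fun n m => (h8 n m).2, h2, h3, h4⟩

namespace IsLatticeSolution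

variable {σ : ℤ → ℤ → LatticeState K}

theorem mu_eq (h : IsLatticeSolution δ y τ ρ S σ) (n m : ℤ) :
    (σ n m).mu τ = algebraMap ℂ K (signedTau τ n m) := by
  rw [mu, h.n_eq, h.m_eq]

theorem a_eq (h : IsLatticeSolution δ y τ ρ S σ) (n m : ℤ) : (σ n m).a = (σ (n + 1) m).T := by
  rw [h.succ_fst]
  rfl

theorem b_eq (h : IsLatticeSolution δ y τ ρ S σ) (n m : ℤ) : (σ n m).b = (σ n (m + 1)).T := by
  rw [h.succ_snd]
  rfl

theorem h1 (h : IsLatticeSolution δ y τ ρ S σ) (n m : ℤ) :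
    ((σ n m).T - (σ (n + 1) (m + 1)).T) * ((σ (n + 1) m).T - (σ n (m + 1)).T) = y := by
  have h2 : (σ (n + 1) (m + 1)).T = (σ n m).T - y / ((σ n m).a - (σ n m).b) := by
    rw [← h.b_eq, h.succ_fst]
    rfl
  rw [h2, ← h.a_eq, ← h.b_eq, sub_sub_cancel, div_mul_cancel₀ _ (h.admissible n m).sub_ne_zero]

theorem sub_one_fst (h : IsLatticeSolution δ y τ ρ S σ) (hy0 : y ≠ 0) (n m : ℤ) :
    (σ (n - 1) m).T = (σ n m).a + (σ n m).n / (δ (σ n m).T + (σ n m).mu τ * (σ n m).T) := by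
  have h2 := h.succ_fst (n - 1) m
  rw [sub_add_cancel] at h2
  have h3 : (σ (n - 1) m) = ((σ n m).reflectFst δ τ).flipFst y := by
    rw [h2, reflectFst_reflectFst, flipFst_flipFst hy0]
  rw [h3]
  rfl

theorem sub_one_snd (h : IsLatticeSolution δ y τ ρ S σ) (hy0 : y ≠ 0) (n m : ℤ) :
    (σ n (m - 1)).T = (σ n m).b + (σ n m).m / ((σ n m).mu τ * (σ n m).T - δ (σ n m).T) := by
  have h2 := h.succ_snd n (m - 1)
  rw [sub_add_cancel] at h2
  have h3 : (σ n (m - 1)) = ((σ n m).reflectSnd δ τ).flipSnd y := by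
    rw [h2, reflectSnd_reflectSnd, flipSnd_flipSnd hy0]
  rw [h3]
  rfl

theorem invariant_fst (h : IsLatticeSolution δ y τ ρ S σ) (hτ : τ ≠ 0) (hy0 : y ≠ 0) (n m : ℤ) :
    ((σ (n + 1) m).T - (σ (n - 1) m).T) * (δ (σ n m).T + (σ n m).mu τ * (σ n m).T) + n = 0 := by
  rw [h.sub_one_fst hy0, ← h.a_eq, h.n_eq]
  by_cases hP : δ (σ n m).T + (σ n m).mu τ * (σ n m).T = 0
  · have := (h.admissible n m).eq_zero_of_fst_eq_zero hτ hP
    rw [h.n_eq] at this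
    simp [this]
  · field_simp
    ring

theorem invariant_snd (h : IsLatticeSolution δ y τ ρ S σ) (hτ : τ ≠ 0) (hy0 : y ≠ 0) (n m : ℤ) :
    ((σ n (m + 1)).T - (σ n (m - 1)).T) * ((σ n m).mu τ * (σ n m).T - δ (σ n m).T) + m = 0 := by
  rw [h.sub_one_snd hy0, ← h.b_eq, h.m_eq]
  by_cases hQ : (σ n m).mu τ * (σ n m).T - δ (σ n m).T = 0
  · have := (h.admissible n m).eq_zero_of_snd_eq_zero hτ hQ
    rw [h.m_eq] at this
    simp [this]
  · field_simp
    ring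

/-- For `n = 0` the second equation says that `y` times the shifted `P` is `(a - b)² P`. -/
theorem fst_eq_zero_succ_iff (h : IsLatticeSolution δ y τ ρ S σ) (hy0 : y ≠ 0) (m : ℤ) :
    δ (σ 0 (m + 1)).T + (σ 0 (m + 1)).mu τ * (σ 0 (m + 1)).T = 0 ↔
      δ (σ 0 m).T + (σ 0 m).mu τ * (σ 0 m).T = 0 := by
  have h2 := (h.admissible 0 m).system.snd
  rw [h.n_eq, Int.cast_zero, add_zero] at h2
  rw [← h.b_eq, h.mu_eq 0 (m + 1), signedTau_succ_snd, map_neg, ← h.mu_eq]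
  have h3 : y * (δ (σ 0 m).b + -(σ 0 m).mu τ * (σ 0 m).b)
      = ((σ 0 m).a - (σ 0 m).b) ^ 2 * (δ (σ 0 m).T + (σ 0 m).mu τ * (σ 0 m).T) := by
    linear_combination h2
  rw [← mul_eq_zero_iff_left hy0, h3, mul_eq_zero_iff_left
    (pow_ne_zero 2 (h.admissible 0 m).sub_ne_zero)]

theorem snd_eq_zero_succ_iff (h : IsLatticeSolution δ y τ ρ S σ) (hy0 : y ≠ 0) (n : ℤ) :
    (σ (n + 1) 0).mu τ * (σ (n + 1) 0).T - δ (σ (n + 1) 0).T = 0 ↔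
      (σ n 0).mu τ * (σ n 0).T - δ (σ n 0).T = 0 := by
  have h2 := (h.admissible n 0).system.fst
  rw [h.m_eq, Int.cast_zero, sub_zero] at h2
  rw [← h.a_eq, h.mu_eq (n + 1) 0, signedTau_succ_fst, map_neg, ← h.mu_eq]
  have h3 : y * (-(σ n 0).mu τ * (σ n 0).a - δ (σ n 0).a)
      = -((σ n 0).a - (σ n 0).b) ^ 2 * ((σ n 0).mu τ * (σ n 0).T - δ (σ n 0).T) := by
    linear_combination -h2
  rw [← mul_eq_zero_iff_left hy0, h3, mul_eq_zero_iff_left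
    (neg_ne_zero.2 (pow_ne_zero 2 (h.admissible n 0).sub_ne_zero))]

theorem fst_eq_zero_iff (h : IsLatticeSolution δ y τ ρ S σ) (hy0 : y ≠ 0) (m m' : ℤ) :
    δ (σ 0 m).T + (σ 0 m).mu τ * (σ 0 m).T = 0 ↔
      δ (σ 0 m').T + (σ 0 m').mu τ * (σ 0 m').T = 0 := by
  induction m using Int.inductionOn' (b := m') with
  | zero => rfl
  | succ k _ ih => rw [h.fst_eq_zero_succ_iff hy0, ih]
  | pred k _ ih => rw [← h.fst_eq_zero_succ_iff hy0, sub_add_cancel, ih]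

theorem snd_eq_zero_iff (h : IsLatticeSolution δ y τ ρ S σ) (hy0 : y ≠ 0) (n n' : ℤ) :
    (σ n 0).mu τ * (σ n 0).T - δ (σ n 0).T = 0 ↔
      (σ n' 0).mu τ * (σ n' 0).T - δ (σ n' 0).T = 0 := by
  induction n using Int.inductionOn' (b := n') with
  | zero => rfl
  | succ k _ ih => rw [h.snd_eq_zero_succ_iff hy0, ih]
  | pred k _ ih => rw [← h.snd_eq_zero_succ_iff hy0, sub_add_cancel, ih]

end IsLatticeSolution
end LatticeState
end Lattice


/-! ### Equivalence of the differential system with Painlevé V and the quadrature. -/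

section PainleveV

variable {K : Type*} [Field K] [Algebra ℂ K]

/-- The Painlevé V equation and the quadrature in a differential field. -/
structure IsAlgebraicPair (δ : Derivation ℂ K K) (y μ n m ρ τ G T : K) : Prop where
  G_ne_zero : G ≠ 0
  G_ne_one : G ≠ 1
  T_ne_zero : T ≠ 0
  quadrature : δ T / T = μ * ((1 + G) / (1 - G))
  painleve : δ (δ G) = (1 / (2 * G) + 1 / (G - 1)) * (δ G) ^ 2 - 1 / y * δ G
        + n ^ 2 / 2 * (G * (G - 1) ^ 2 / y ^ 2) + -m ^ 2 / 2 * ((G - 1) ^ 2 / (y ^ 2 * G))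
        + (ρ - μ) * (G / y) + -2 * τ ^ 2 * (G * (G + 1) / (G - 1))

variable {δ : Derivation ℂ K K} {y μ κ n m ρ τ G T z a b : K}

/-- The first order system for `G` and `z` is equivalent to Painlevé V. -/
theorem painleve_of_system (hy : δ y = 1) (hy0 : y ≠ 0) (hG : G ≠ 0) (hG1 : G ≠ 1)
    (hμ : δ μ = 0) (hn : δ n = 0) (hm : δ m = 0)
    (h1 : y * δ G = -2 * μ * y * G - (1 - G) * (2 * z - n * G - m)) :
    (y * δ z = 2 * μ * y * G * (κ + z) / (1 - G) - z * (z - m) * (1 - G) / G) ↔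
     δ (δ G) = (1 / (2 * G) + 1 / (G - 1)) * (δ G) ^ 2 - 1 / y * δ G
        + n ^ 2 / 2 * (G * (G - 1) ^ 2 / y ^ 2) + -m ^ 2 / 2 * ((G - 1) ^ 2 / (y ^ 2 * G))
        + -2 * μ * (2 * κ + n + m + 1) * (G / y) + -2 * μ ^ 2 * (G * (G + 1) / (G - 1)) := by
  have := charZero_of_algebra_complex K
  have h2 : δ 2 = 0 := by exact_mod_cast δ.map_natCast 2
  have h3 := congrArg δ h1
  simp only [map_sub, map_neg, Derivation.leibniz, smul_eq_mul, hμ, hn, hm, hy, h2,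
    Derivation.map_one_eq_zero] at h3
  have hG2 : 1 - G ≠ 0 := sub_ne_zero.2 hG1.symm
  have hG3 : G - 1 ≠ 0 := sub_ne_zero.2 hG1
  have h4 : δ (δ G) = (-δ G - 2 * μ * (G + y * δ G) + δ G * (2 * z - n * G - m)
      - (1 - G) * (2 * δ z - n * δ G)) / y := by
    rw [eq_div_iff hy0]
    linear_combination h3
  have h5 : δ G = (-2 * μ * y * G - (1 - G) * (2 * z - n * G - m)) / y := by
    rw [eq_div_iff hy0]
    linear_combination h1
  have h6 : δ (δ G) - ((1 / (2 * G) + 1 / (G - 1)) * (δ G) ^ 2 - 1 / y * δ G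
        + n ^ 2 / 2 * (G * (G - 1) ^ 2 / y ^ 2) + -m ^ 2 / 2 * ((G - 1) ^ 2 / (y ^ 2 * G))
        + -2 * μ * (2 * κ + n + m + 1) * (G / y) + -2 * μ ^ 2 * (G * (G + 1) / (G - 1)))
      -- With `z` defined by the equation for `δ G`, the two equations differ only by this nonzero
      -- factor.
      = - 2 * (1 - G) / y ^ 2 *
        (y * δ z - (2 * μ * y * G * (κ + z) / (1 - G) - z * (z - m) * (1 - G) / G)) := by
    rw [h4, h5, ← neg_sub 1 G]
    field_simp
    ring
  have h7 : - 2 * (1 - G) / y ^ 2 ≠ 0 :=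
    div_ne_zero (mul_ne_zero (by norm_num) hG2) (pow_ne_zero 2 hy0)
  rw [← sub_eq_zero, ← sub_eq_zero (a := δ (δ G)), h6, mul_eq_zero, or_iff_right h7]

theorem SimilaritySystem.isAlgebraicPair (h : SimilaritySystem δ y μ κ n m T a b)
    (hy : δ y = 1) (hy0 : y ≠ 0) (hμ0 : μ ≠ 0) (hT : T ≠ 0) (hv : a - b ≠ 0)
    (hμ : δ μ = 0) (hκ : δ κ = 0) (hn : δ n = 0) (hm : δ m = 0)
    (hρ : ρ - μ = -2 * μ * (2 * κ + n + m + 1)) (hτ : τ ^ 2 = μ ^ 2)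
    (hP : δ T + μ * T ≠ 0) (hQ : μ * T - δ T ≠ 0) :
    IsAlgebraicPair δ y μ n m ρ τ (-(μ * T - δ T) / (δ T + μ * T)) T := by
  have := charZero_of_algebra_complex K
  have hs := h.second_order hμ hκ hv
  have h5 : δ (δ T) = (y * μ ^ 2 * T - 2 * (a - b) * (δ T + μ * T) * (μ * T - δ T)
      - n * (μ * T - δ T) + m * (δ T + μ * T)) / y := by
    rw [eq_div_iff hy0]
    linear_combination hs
  set G := -(μ * T - δ T) / (δ T + μ * T) with hGdef
  have hG : G ≠ 0 := div_ne_zero (neg_ne_zero.2 hQ) hP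
  have h1G : 1 - G = 2 * μ * T / (δ T + μ * T) := by
    rw [hGdef]
    field_simp
    ring
  have hG1 : 1 - G ≠ 0 := by
    rw [h1G]
    exact div_ne_zero (mul_ne_zero (mul_ne_zero two_ne_zero hμ0) hT) hP
  have hδG : y * δ G = -2 * μ * y * G
      - (1 - G) * (2 * ((a - b) * (μ * T - δ T)) - n * G - m) := by
    rw [h1G, hGdef, Derivation.leibniz_div]
    simp only [map_add, map_sub, map_neg, Derivation.leibniz, smul_eq_mul, hμ]
    rw [h5]
    field_simp
    ring
  have hG1' : G ≠ 1 := fun h => hG1 (by rw [h, sub_self])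
  refine ⟨hG, hG1', hT, ?_, ?_⟩
  · have h1G' : 1 + G = 2 * δ T / (δ T + μ * T) := by
      rw [hGdef]
      field_simp
      ring
    rw [h1G, h1G', div_div_div_cancel_right₀ hP]
    field_simp
  · rw [hρ, hτ]
    refine (painleve_of_system hy hy0 hG hG1' hμ hn hm hδG).1 ?_
    obtain ⟨ha, hb, hk⟩ := h
    rw [h1G, hGdef, ← hk]
    simp only [map_sub, Derivation.leibniz, smul_eq_mul, hμ]
    have ha : δ a = (-(μ * y * a) + (a - b) * ((a - b) * (μ * T - δ T) - m)) / y := by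
      rw [eq_div_iff hy0, ← ha]; ring
    have hb : δ b = (μ * y * b + (a - b) * ((a - b) * (δ T + μ * T) + n)) / y := by
      rw [eq_div_iff hy0, ← hb]; ring
    rw [h5, ha, hb]
    field_simp
    ring

/-- The quadrature determines `P` and `Q` from `G` and `T`, and the equation for `δ G` determines
`z`. -/
theorem IsAlgebraicPair.exists_similaritySystem (h : IsAlgebraicPair δ y μ n m ρ τ G T)
    (hy : δ y = 1) (hy0 : y ≠ 0) (hμ0 : μ ≠ 0)
    (hμ : δ μ = 0) (hκ : δ κ = 0) (hn : δ n = 0) (hm : δ m = 0)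
    (hρ : ρ - μ = -2 * μ * (2 * κ + n + m + 1)) (hτ : τ ^ 2 = μ ^ 2) :
    ∃ a b z : K, SimilaritySystem δ y μ κ n m T a b ∧
      δ T + μ * T = 2 * μ * T / (1 - G) ∧ μ * T - δ T = -(2 * μ * T * G / (1 - G)) ∧
      z = (a - b) * (μ * T - δ T) ∧
      y * δ G = -2 * μ * y * G - (1 - G) * (2 * z - n * G - m) ∧
      y * δ z = 2 * μ * y * G * (κ + z) / (1 - G) - z * (z - m) * (1 - G) / G := by
  have := charZero_of_algebra_complex K
  obtain ⟨hG, hG1, hT, hq, hp⟩ := h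
  have hG2 : 1 - G ≠ 0 := sub_ne_zero.2 hG1.symm
  have hδT : δ T = μ * T * (1 + G) / (1 - G) := by
    rw [div_eq_iff hT] at hq
    rw [hq]
    ring
  have hP : δ T + μ * T = 2 * μ * T / (1 - G) := by
    rw [hδT]
    field_simp
    ring
  have hQ : μ * T - δ T = -(2 * μ * T * G / (1 - G)) := by
    rw [hδT]
    field_simp
    ring
  obtain ⟨z, hz⟩ : ∃ z, y * δ G = -2 * μ * y * G - (1 - G) * (2 * z - n * G - m) := by
    refine ⟨((-2 * μ * y * G - y * δ G) / (1 - G) + n * G + m) / 2, ?_⟩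
    field_simp
    ring
  rw [hρ, hτ] at hp
  have hz2 := (painleve_of_system hy hy0 hG hG1 hμ hn hm hz).2 hp
  have h2 : δ 2 = 0 := by exact_mod_cast δ.map_natCast 2
  have hδG : δ G = (-2 * μ * y * G - (1 - G) * (2 * z - n * G - m)) / y := by
    rw [eq_div_iff hy0]
    linear_combination hz
  have hδz : δ z = (2 * μ * y * G * (κ + z) / (1 - G) - z * (z - m) * (1 - G) / G) / y := by
    rw [eq_div_iff hy0]
    linear_combination hz2
  -- These solve the linear equations `aP + bQ = κ` and `(a - b)Q = z`; adding them and using `P + Q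
  -- = 2μT` gives `a`, and then `b = a - z / Q`.
  refine ⟨(z + κ) / (2 * μ * T), (z + κ) / (2 * μ * T) + z * (1 - G) / (2 * μ * T * G), z,
    ⟨?_, ?_, ?_⟩, hP, hQ, ?_, hz, hz2⟩
  · rw [hQ, Derivation.leibniz_div]
    simp only [map_add, Derivation.leibniz, smul_eq_mul, hμ, hκ, h2]
    rw [hδT, hδz]
    field_simp
    ring
  · rw [hP, map_add, Derivation.leibniz_div, Derivation.leibniz_div]
    simp only [map_add, map_sub, Derivation.leibniz, smul_eq_mul, hμ, hκ, h2,
      Derivation.map_one_eq_zero]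
    rw [hδT, hδz, hδG]
    field_simp
    ring
  · rw [hP, hQ]
    field_simp
    ring
  · rw [hQ]
    field_simp
    ring

end PainleveV

open scoped IntermediateField.algebraAdjoinAdjoin

/-! ### The theorem in an abstract differential field. -/

section AlgebraicTheorem

variable {K : Type*} [Field K] [Algebra ℂ K]

/-- The Painlevé V pair condition at `(n, m)` in a differential field. -/
def IsAlgebraicPairAt (δ : Derivation ℂ K K) (y : K) (τ ρ : ℝ) (n m : ℤ) (G T : K) : Prop :=
  IsAlgebraicPair δ y (algebraMap ℂ K (signedTau τ n m)) n m (algebraMap ℂ K ρ) (algebraMap ℂ K τ)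
    G T

variable {δ : Derivation ℂ K K} {y : K} {τ ρ : ℝ} {S : Set K}

theorem rho_sub_mu (K : Type*) [Field K] [Algebra ℂ K] {τ : ℝ} (hτ : τ ≠ 0) (ρ : ℝ) (n m : ℤ) :
    algebraMap ℂ K ρ - algebraMap ℂ K (signedTau τ n m)
      = -2 * algebraMap ℂ K (signedTau τ n m) *
        (2 * algebraMap ℂ K (firstIntegral τ ρ n m) + n + m + 1) := by
  have hμ := signedTau_ne_zero hτ n m
  have h : (ρ : ℂ) - signedTau τ n m
      = -2 * signedTau τ n m * (2 * firstIntegral τ ρ n m + n + m + 1) := by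
    rw [firstIntegral]
    field_simp
    ring
  have := congrArg (algebraMap ℂ K) h
  simpa only [map_sub, map_mul, map_neg, map_add, map_intCast, map_ofNat, map_one] using this

theorem tau_sq (K : Type*) [Field K] [Algebra ℂ K] (τ : ℝ) (n m : ℤ) :
    algebraMap ℂ K τ ^ 2 = algebraMap ℂ K (signedTau τ n m) ^ 2 := by
  rw [← map_pow, ← map_pow, signedTau_sq]

theorem IsAlgebraicPairAt.exists_isAdmissible {n m : ℤ} {G T : K}
    (h : IsAlgebraicPairAt δ y τ ρ n m G T) (hτ : τ ≠ 0) (hy : δ y = 1) (hy0 : y ≠ 0)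
    (hS : S ⊆ {y, G, δ G})
    (hres : (∀ k : ℤ, ρ ≠ (2 * (k : ℝ) + 1) * τ) ∨
      ∀ e : K, ¬ {y, G, δ G} ⊆ (adjoin ℂ {y, e} : Set K)) :
    ∃ a b : K, (⟨n, m, T, a, b⟩ : LatticeState K).IsAdmissible δ y τ ρ S ∧
      δ T + algebraMap ℂ K (signedTau τ n m) * T ≠ 0 ∧
      algebraMap ℂ K (signedTau τ n m) * T - δ T ≠ 0 := by
  have := charZero_of_algebra_complex K
  have hμ0 : algebraMap ℂ K (signedTau τ n m) ≠ 0 := by simpa using signedTau_ne_zero hτ n m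
  obtain ⟨a, b, z, hs, hP, hQ, hz, h1, h2⟩ := IsAlgebraicPair.exists_similaritySystem
    (κ := algebraMap ℂ K (firstIntegral τ ρ n m)) h hy hy0 hμ0
    (δ.map_algebraMap _) (δ.map_algebraMap _) (Derivation.map_intCast δ _)
    (Derivation.map_intCast δ _) (rho_sub_mu K hτ ρ n m) (tau_sq K τ n m)
  obtain ⟨hG, hG1, hT, -, -⟩ := h
  have hG2 : 1 - G ≠ 0 := sub_ne_zero.2 hG1.symm
  have hμF (F : IntermediateField ℂ K) : algebraMap ℂ K (signedTau τ n m) ∈ F :=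
    F.algebraMap_mem _
  have hκ : firstIntegral τ ρ n m = 0 →
      ¬ ∀ k : ℤ, ρ ≠ (2 * (k : ℝ) + 1) * τ := by
    intro h0 hk
    refine firstIntegral_ne hτ hk n m (n + m) ?_
    rw [h0]
    push_cast
    ring
  generalize hμ : algebraMap ℂ K (signedTau τ n m) = μ at *
  -- If `z = 0`, the equation for `δ z` forces `κ = 0`, a resonance, and the equation for `δ G`
  -- becomes a Riccati equation, placing `δ G` in `ℂ(y, G)`.
  have hz0 : z ≠ 0 := by
    intro h0
    rw [h0] at h1 h2
    simp only [map_zero, mul_zero, zero_mul, zero_div, sub_zero, add_zero, zero_sub] at h1 h2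
    have h3 : algebraMap ℂ K (firstIntegral τ ρ n m) = 0 := by
      have := h2.symm
      rw [div_eq_zero_iff, or_iff_left hG2] at this
      simpa [hμ0, hy0, hG] using this
    have h4 := hκ ((map_eq_zero _).1 h3)
    refine hres.resolve_left h4 G ?_
    have hyF : y ∈ adjoin ℂ {y, G} := IntermediateField.subset_adjoin ℂ _ (by simp)
    have hGF : G ∈ adjoin ℂ {y, G} := IntermediateField.subset_adjoin ℂ _ (by simp)
    simp only [Set.insert_subset_iff, Set.singleton_subset_iff, SetLike.mem_coe]
    refine ⟨hyF, hGF, ?_⟩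
    have h5 : δ G = (-2 * μ * y * G - (1 - G) * (-(n * G) - m)) / y := by
      rw [eq_div_iff hy0]
      linear_combination h1
    rw [h5]
    exact div_mem (sub_mem (mul_mem (mul_mem (mul_mem (neg_mem (ofNat_mem _ 2)) (hμF _)) hyF) hGF)
      (mul_mem (sub_mem (one_mem _) hGF) (sub_mem (neg_mem (mul_mem (intCast_mem _ _) hGF))
        (intCast_mem _ _)))) hyF
  have hv : a - b ≠ 0 := fun h0 => hz0 (by rw [hz, h0, zero_mul])
  refine ⟨a, b, ⟨hT, hv, ?_, ?_⟩, ?_, ?_⟩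
  · rwa [LatticeState.mu, hμ]
  · set F := LatticeState.invariantField δ y (⟨n, m, T, a, b⟩ : LatticeState K) with hF
    obtain ⟨hyF, h4, h5, h6⟩ := LatticeState.mem_invariantField (δ := δ) (y := y)
      (σ := (⟨n, m, T, a, b⟩ : LatticeState K))
    rw [← hF] at hyF h4 h5 h6
    dsimp only at h4 h5 h6
    have h7 : G = 1 - 2 * μ / (δ T / T + μ) := by
      have : δ T / T + μ = 2 * μ / (1 - G) := by
        rw [show δ T / T + μ = (δ T + μ * T) / T by field_simp, hP]
        field_simp
      rw [this]
      field_simp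
      ring
    have hGF : G ∈ F := by
      rw [h7]
      exact sub_mem (one_mem _) (div_mem (mul_mem (ofNat_mem _ 2) (hμF _)) (add_mem h4 (hμF _)))
    have hzF : z ∈ F := by
      have : z = (a * T - b * T) * (μ - δ T / T) := by
        rw [hz]
        field_simp
      rw [this]
      exact mul_mem (sub_mem h5 h6) (sub_mem (hμF _) h4)
    refine hS.trans ?_
    simp only [Set.insert_subset_iff, Set.singleton_subset_iff, SetLike.mem_coe]
    refine ⟨hyF, hGF, ?_⟩
    have h8 : δ G = (-2 * μ * y * G - (1 - G) * (2 * z - n * G - m)) / y := by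
      rw [eq_div_iff hy0]
      linear_combination h1
    rw [h8]
    exact div_mem (sub_mem (mul_mem (mul_mem (mul_mem (neg_mem (ofNat_mem _ 2)) (hμF _)) hyF) hGF)
      (mul_mem (sub_mem (one_mem _) hGF) (sub_mem (sub_mem (mul_mem (ofNat_mem _ 2) hzF)
        (mul_mem (intCast_mem _ _) hGF)) (intCast_mem _ _)))) hyF
  · rw [hP]
    exact div_ne_zero (mul_ne_zero (mul_ne_zero two_ne_zero hμ0) hT) hG2
  · rw [hQ]
    exact neg_ne_zero.2 (div_ne_zero (mul_ne_zero (mul_ne_zero (mul_ne_zero two_ne_zero hμ0) hT)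
      hG) hG2)

namespace LatticeState

/-- If `P = 0`, then `δ T / T = -μ` and the integral makes `bT` a constant, so the invariant field
lies in `ℂ(y, aT)`. -/
theorem IsAdmissible.fst_ne_zero {σ : LatticeState K} (h : σ.IsAdmissible δ y τ ρ S) (hτ : τ ≠ 0)
    (hS : ∀ e : K, ¬ S ⊆ adjoin ℂ {y, e}) : δ σ.T + σ.mu τ * σ.T ≠ 0 := by
  have := charZero_of_algebra_complex K
  intro hP
  have hT := h.ne_zero
  have hμ := mu_ne_zero (σ := σ) (K := K) hτ
  refine hS (σ.a * σ.T) (h.subset_field.trans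
    (invariantField_le (IntermediateField.subset_adjoin ℂ _ (by simp)) ?_
      (IntermediateField.subset_adjoin ℂ _ (by simp)) ?_))
  · rw [eq_neg_of_add_eq_zero_left hP, neg_div, mul_div_cancel_right₀ _ hT]
    exact neg_mem (mu_mem _)
  · have : σ.b * σ.T = algebraMap ℂ K (firstIntegral τ ρ σ.n σ.m) / (2 * σ.mu τ) := by
      field_simp
      linear_combination h.system.integral + (σ.b - σ.a) * hP
    rw [this]
    exact div_mem (IntermediateField.algebraMap_mem _ _) (mul_mem (ofNat_mem _ 2) (mu_mem _))

theorem IsAdmissible.snd_ne_zero {σ : LatticeState K} (h : σ.IsAdmissible δ y τ ρ S) (hτ : τ ≠ 0)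
    (hS : ∀ e : K, ¬ S ⊆ adjoin ℂ {y, e}) : σ.mu τ * σ.T - δ σ.T ≠ 0 := by
  have := charZero_of_algebra_complex K
  intro hQ
  have hT := h.ne_zero
  have hμ := mu_ne_zero (σ := σ) (K := K) hτ
  refine hS (σ.b * σ.T) (h.subset_field.trans
    (invariantField_le (IntermediateField.subset_adjoin ℂ _ (by simp)) ?_ ?_
      (IntermediateField.subset_adjoin ℂ _ (by simp))))
  · rw [← sub_eq_zero.1 hQ, mul_div_cancel_right₀ _ hT]
    exact mu_mem _
  · have : σ.a * σ.T = algebraMap ℂ K (firstIntegral τ ρ σ.n σ.m) / (2 * σ.mu τ) := by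
      field_simp
      linear_combination h.system.integral + (σ.a - σ.b) * hQ
    rw [this]
    exact div_mem (IntermediateField.algebraMap_mem _ _) (mul_mem (ofNat_mem _ 2) (mu_mem _))

end LatticeState

/-- The equations of a continuously invariant solution of H1 in a differential field. -/
structure IsAlgebraicLatticeSolution (δ : Derivation ℂ K K) (y : K) (τ : ℝ) (T : ℤ → ℤ → K) :
    Prop where
  h1 : ∀ n m, (T n m - T (n + 1) (m + 1)) * (T (n + 1) m - T n (m + 1)) = y
  invariant_fst : ∀ n m, (T (n + 1) m - T (n - 1) m) *
    (δ (T n m) + algebraMap ℂ K (signedTau τ n m) * T n m) + n = 0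
  invariant_snd : ∀ n m, (T n (m + 1) - T n (m - 1)) *
    (algebraMap ℂ K (signedTau τ n m) * T n m - δ (T n m)) + m = 0

theorem LatticeState.IsLatticeSolution.isAlgebraicLatticeSolution {σ : ℤ → ℤ → LatticeState K}
    (h : IsLatticeSolution δ y τ ρ S σ) (hτ : τ ≠ 0) (hy0 : y ≠ 0) :
    IsAlgebraicLatticeSolution δ y τ fun n m => (σ n m).T where
  h1 := h.h1
  invariant_fst n m := by rw [← h.mu_eq]; exact h.invariant_fst hτ hy0 n m
  invariant_snd n m := by rw [← h.mu_eq]; exact h.invariant_snd hτ hy0 n m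

theorem LatticeState.IsLatticeSolution.isAlgebraicPairAt {σ : ℤ → ℤ → LatticeState K}
    (h : IsLatticeSolution δ y τ ρ S σ) (hτ : τ ≠ 0) (hy : δ y = 1) (hy0 : y ≠ 0) {n m : ℤ}
    (hP : δ (σ n m).T + (σ n m).mu τ * (σ n m).T ≠ 0)
    (hQ : (σ n m).mu τ * (σ n m).T - δ (σ n m).T ≠ 0) :
    IsAlgebraicPairAt δ y τ ρ n m (-((σ n m).mu τ * (σ n m).T - δ (σ n m).T) /
      (δ (σ n m).T + (σ n m).mu τ * (σ n m).T)) (σ n m).T := by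
  have hs := (h.admissible n m).system
  have hv := (h.admissible n m).sub_ne_zero
  have hT := (h.admissible n m).ne_zero
  have hμ0 := LatticeState.mu_ne_zero (σ := σ n m) (K := K) hτ
  rw [h.n_eq, h.m_eq] at hs
  rw [h.mu_eq] at *
  exact hs.isAlgebraicPair hy hy0 hμ0 hT hv (δ.map_algebraMap _) (δ.map_algebraMap _)
    (Derivation.map_intCast δ _) (Derivation.map_intCast δ _) (rho_sub_mu K hτ ρ n m)
    (tau_sq K τ n m) hP hQ

theorem IsAlgebraicPairAt.exists_lattice_of_not_subset {n₀ m₀ : ℤ} {G₀ T₀ : K}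
    (h : IsAlgebraicPairAt δ y τ ρ n₀ m₀ G₀ T₀) (hτ : τ ≠ 0) (hy : δ y = 1) (hy0 : y ≠ 0)
    (hS : ∀ e : K, ¬ {y, G₀, δ G₀} ⊆ (adjoin ℂ {y, e} : Set K)) :
    ∃ T : ℤ → ℤ → K, T n₀ m₀ = T₀ ∧ IsAlgebraicLatticeSolution δ y τ T ∧
      ∀ n m, ∃ G, IsAlgebraicPairAt δ y τ ρ n m G (T n m) := by
  obtain ⟨a, b, hadm, -, -⟩ := h.exists_isAdmissible hτ hy hy0 subset_rfl (Or.inr hS)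
  obtain ⟨σ, h1, h2⟩ := LatticeState.exists_isLatticeSolution hτ (Or.inr hS) hy hy0 hadm
  refine ⟨fun n m => (σ n m).T, congrArg LatticeState.T h1, h2.isAlgebraicLatticeSolution hτ hy0,
    fun n m => ⟨_, h2.isAlgebraicPairAt hτ hy hy0 ((h2.admissible n m).fst_ne_zero hτ hS)
      ((h2.admissible n m).snd_ne_zero hτ hS)⟩⟩

/-- No field condition is needed here, so `S = ∅`. `P` can vanish only if `n = 0`; then `n₀ = 0` and
the vanishing would propagate along that line to the seed. The argument for `Q` is the same. -/
theorem IsAlgebraicPairAt.exists_lattice_of_ne {n₀ m₀ : ℤ} {G₀ T₀ : K}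
    (h : IsAlgebraicPairAt δ y τ ρ n₀ m₀ G₀ T₀) (hτ : τ ≠ 0) (hy : δ y = 1) (hy0 : y ≠ 0)
    (hρ : ∀ k : ℤ, ρ ≠ (2 * (k : ℝ) + 1) * τ) :
    ∃ T : ℤ → ℤ → K, T n₀ m₀ = T₀ ∧ IsAlgebraicLatticeSolution δ y τ T ∧
      ∀ n m, (n = 0 → n₀ = 0) → (m = 0 → m₀ = 0) →
        ∃ G, IsAlgebraicPairAt δ y τ ρ n m G (T n m) := by
  obtain ⟨a, b, hadm, hP, hQ⟩ := h.exists_isAdmissible hτ hy hy0 (Set.empty_subset _) (Or.inl hρ)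
  obtain ⟨σ, h1, h2⟩ := LatticeState.exists_isLatticeSolution hτ (Or.inl hρ) hy hy0 hadm
  dsimp only at h1
  refine ⟨fun n m => (σ n m).T, congrArg LatticeState.T h1, h2.isAlgebraicLatticeSolution hτ hy0,
    fun n m hn hm => ⟨_, h2.isAlgebraicPairAt hτ hy hy0 ?_ ?_⟩⟩
  · intro h3
    have h4 := (h2.admissible n m).eq_zero_of_fst_eq_zero hτ h3
    rw [h2.n_eq] at h4
    obtain rfl := hn h4
    subst h4
    rw [h2.fst_eq_zero_iff hy0 m m₀, h1] at h3
    exact hP h3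
  · intro h3
    have h4 := (h2.admissible n m).eq_zero_of_snd_eq_zero hτ h3
    rw [h2.m_eq] at h4
    obtain rfl := hm h4
    subst h4
    rw [h2.snd_eq_zero_iff hy0 n n₀, h1] at h3
    exact hQ h3

/-- Three algebraically independent elements are not contained in a field generated by two. -/
theorem AlgebraicIndependent.not_subset_adjoin_pair {x : Fin 3 → K}
    (hx : AlgebraicIndependent ℂ x) (e₁ e₂ : K) :
    ¬ Set.range x ⊆ (adjoin ℂ {e₁, e₂} : Set K) := by
  intro h
  -- In the matroid of algebraic independence, the closure of a pair has rank at most two.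
  let M := AlgebraicIndependent.matroid ℂ K
  have h1 : M.Indep (Set.range x) := hx.coe_range
  have h2 : Set.range x ⊆ M.closure {e₁, e₂} := by
    intro z hz
    rw [AlgebraicIndependent.matroid_closure_eq, SetLike.mem_coe, Subalgebra.mem_algebraicClosure]
    have h3 := Algebra.IsAlgebraic.isAlgebraic (R := Algebra.adjoin ℂ {e₁, e₂})
      (⟨z, h hz⟩ : adjoin ℂ {e₁, e₂})
    exact h3.algebraMap (A := K)
  have h3 := h1.encard_le_eRk_of_subset h2
  rw [Matroid.eRk_closure_eq] at h3
  have h4 := ((hx.injective.encard_range.trans h3).trans (M.eRk_le_encard _)).trans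
    (Set.encard_insert_le {e₂} e₁)
  rw [ENat.card_eq_coe_fintype_card, Fintype.card_fin, Set.encard_singleton] at h4
  norm_num at h4

end AlgebraicTheorem

/-! ### The differential field of meromorphic functions on `D`. -/

section MeromorphicField

/-- The algebra of functions that are meromorphic on `D`. -/
def meromorphicSubalgebra (D : Set ℂ) : Subalgebra ℂ (ℂ → ℂ) where
  carrier := {f | MeromorphicOn f D}
  mul_mem' hf hg := hf.mul hg
  add_mem' hf hg := hf.add hg
  algebraMap_mem' c := MeromorphicOn.const c

/-- The ideal of functions vanishing outside a closed discrete set. -/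
def vanishingIdeal (D : Set ℂ) : Ideal (meromorphicSubalgebra D) where
  carrier := {f | (f : ℂ → ℂ) =ᶠ[codiscreteWithin D] 0}
  add_mem' {f g} hf hg := by
    change (f : ℂ → ℂ) + (g : ℂ → ℂ) =ᶠ[codiscreteWithin D] 0
    filter_upwards [hf, hg] with y h1 h2
    simp [h1, h2]
  zero_mem' := show (0 : ℂ → ℂ) =ᶠ[codiscreteWithin D] 0 from EventuallyEq.rfl
  smul_mem' c f hf := by
    change (c : ℂ → ℂ) * (f : ℂ → ℂ) =ᶠ[codiscreteWithin D] 0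
    filter_upwards [hf] with y h1
    simp [h1]

/-- Meromorphic functions on `D`, identified if they agree outside a closed discrete set. -/
def MeromorphicQuotient (D : Set ℂ) : Type := meromorphicSubalgebra D ⧸ vanishingIdeal D

namespace MeromorphicQuotient

noncomputable instance (D : Set ℂ) : CommRing (MeromorphicQuotient D) :=
  Ideal.Quotient.commRing (vanishingIdeal D)

noncomputable instance (D : Set ℂ) : Algebra ℂ (MeromorphicQuotient D) :=
  Ideal.Quotient.algebra ℂ (I := vanishingIdeal D)

variable {D : Set ℂ} {f g : ℂ → ℂ}

/-- The quotient map. -/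
noncomputable def mkₐ (D : Set ℂ) : meromorphicSubalgebra D →ₐ[ℂ] MeromorphicQuotient D :=
  Ideal.Quotient.mkₐ ℂ (vanishingIdeal D)

/-- The class of a meromorphic function. -/
noncomputable def mk (f : ℂ → ℂ) (hf : MeromorphicOn f D) : MeromorphicQuotient D :=
  mkₐ D ⟨f, hf⟩

theorem mk_eq_iff {hf : MeromorphicOn f D} {hg : MeromorphicOn g D} :
    mk f hf = mk g hg ↔ f =ᶠ[codiscreteWithin D] g := by
  refine (Ideal.Quotient.eq (I := vanishingIdeal D)).trans ?_
  change (f - g =ᶠ[codiscreteWithin D] 0) ↔ _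
  rw [← eventuallyEq_iff_sub]

theorem exists_mk_eq (x : MeromorphicQuotient D) :
    ∃ (f : ℂ → ℂ) (hf : MeromorphicOn f D), mk f hf = x := by
  obtain ⟨⟨f, hf⟩, rfl⟩ := Ideal.Quotient.mk_surjective x
  exact ⟨f, hf, rfl⟩

theorem mk_add (hf : MeromorphicOn f D) (hg : MeromorphicOn g D) :
    mk f hf + mk g hg = mk (f + g) (hf.add hg) := rfl

theorem mk_sub (hf : MeromorphicOn f D) (hg : MeromorphicOn g D) :
    mk f hf - mk g hg = mk (f - g) (hf.sub hg) := rfl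

theorem mk_neg (hf : MeromorphicOn f D) : -mk f hf = mk (-f) hf.neg := rfl

theorem mk_mul (hf : MeromorphicOn f D) (hg : MeromorphicOn g D) :
    mk f hf * mk g hg = mk (f * g) (hf.mul hg) := rfl

theorem mk_pow (hf : MeromorphicOn f D) (n : ℕ) : mk f hf ^ n = mk (f ^ n) (hf.pow n) := rfl

theorem mk_algebraMap (c : ℂ) :
    algebraMap ℂ (MeromorphicQuotient D) c = mk (fun _ => c) (MeromorphicOn.const c) := rfl

theorem zero_eq_mk : (0 : MeromorphicQuotient D) = mk (fun _ => 0) (MeromorphicOn.const 0) := rfl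

theorem one_eq_mk : (1 : MeromorphicQuotient D) = mk (fun _ => 1) (MeromorphicOn.const 1) := rfl

/-- Identity theorem: a nonzero class has no zeros outside a closed discrete set. -/
theorem mk_ne_zero_iff (hD : IsConnected D) (ho : IsOpen D) {hf : MeromorphicOn f D} :
    mk f hf ≠ 0 ↔ ∀ᶠ y in codiscreteWithin D, f y ≠ 0 := by
  rw [zero_eq_mk, Ne, mk_eq_iff]
  constructor
  · intro h
    apply hf.eventually_codiscreteWithin_apply_ne_zero
    rw [← hf.exists_meromorphicOrderAt_ne_top_iff_forall_mem hD]
    by_contra! h1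
    apply h
    rw [EventuallyEq, Filter.Eventually, mem_codiscreteWithin_iff_forall_mem_nhdsNE]
    intro x hx
    exact mem_of_superset (meromorphicOrderAt_eq_top_iff.1 (h1 x hx)) Set.subset_union_left
  · intro h h1
    obtain ⟨x, hx⟩ := hD.nonempty
    have h2 : ∀ᶠ y in codiscreteWithin D, False := by
      filter_upwards [h, h1] with y h2 h3 using h2 h3
    rw [Filter.Eventually, mem_codiscreteWithin_iff_forall_mem_nhdsNE] at h2
    have h3 := h2 x hx
    have h4 : ∀ᶠ y in nhdsWithin x {x}ᶜ, False := by
      filter_upwards [h3, nhdsWithin_le_nhds (ho.mem_nhds hx)] with y h5 h6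
      simp at h5
      exact h5 h6
    exact (NormedField.nhdsNE_neBot x).ne (eventually_false_iff_eq_bot.1 h4)

theorem mk_mul_inv (hD : IsConnected D) (ho : IsOpen D) {hf : MeromorphicOn f D}
    (h : mk f hf ≠ 0) : mk f hf * mk f⁻¹ hf.inv = 1 := by
  rw [mk_mul, one_eq_mk, mk_eq_iff]
  filter_upwards [(mk_ne_zero_iff hD ho).1 h] with y hy
  simp [hy]

theorem isField (hD : IsConnected D) (ho : IsOpen D) : IsField (MeromorphicQuotient D) := by
  refine ⟨⟨0, 1, ?_⟩, fun x z => mul_comm x z, ?_⟩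
  · refine (Ne.symm ?_)
    rw [one_eq_mk, mk_ne_zero_iff hD ho]
    simp
  · intro x hx
    obtain ⟨f, hf, rfl⟩ := exists_mk_eq x
    exact ⟨mk f⁻¹ hf.inv, mk_mul_inv hD ho hx⟩

/-- The derivation induced by differentiation. -/
noncomputable def derivFun (x : MeromorphicQuotient D) : MeromorphicQuotient D :=
  mk (deriv (exists_mk_eq x).choose) (exists_mk_eq x).choose_spec.choose.deriv

/-- Independence of the chosen representative: meromorphic functions agreeing off a closed discrete
set have derivatives agreeing off such a set. -/
theorem derivFun_mk (hf : MeromorphicOn f D) : derivFun (mk f hf) = mk (deriv f) hf.deriv := by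
  have h := (exists_mk_eq (mk f hf)).choose_spec.choose_spec
  rw [derivFun, mk_eq_iff]
  exact MeromorphicOn.deriv_eventuallyEq_codiscreteWithin
    (exists_mk_eq (mk f hf)).choose_spec.choose hf (mk_eq_iff.1 h)

theorem derivFun_add (x z : MeromorphicQuotient D) :
    derivFun (x + z) = derivFun x + derivFun z := by
  obtain ⟨f, hf, rfl⟩ := exists_mk_eq x
  obtain ⟨g, hg, rfl⟩ := exists_mk_eq z
  rw [mk_add, derivFun_mk, derivFun_mk, derivFun_mk, mk_add, mk_eq_iff]
  filter_upwards [hf.eventually_codiscreteWithin_analyticAt,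
    hg.eventually_codiscreteWithin_analyticAt] with y h1 h2
  exact deriv_add h1.differentiableAt h2.differentiableAt

theorem derivFun_mul (x z : MeromorphicQuotient D) :
    derivFun (x * z) = x * derivFun z + z * derivFun x := by
  obtain ⟨f, hf, rfl⟩ := exists_mk_eq x
  obtain ⟨g, hg, rfl⟩ := exists_mk_eq z
  rw [mk_mul, derivFun_mk, derivFun_mk, derivFun_mk, mk_mul, mk_mul, mk_add, mk_eq_iff]
  filter_upwards [hf.eventually_codiscreteWithin_analyticAt,
    hg.eventually_codiscreteWithin_analyticAt] with y h1 h2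
  rw [deriv_mul h1.differentiableAt h2.differentiableAt]
  simp only [Pi.add_apply, Pi.mul_apply]
  ring

theorem derivFun_smul (c : ℂ) (x : MeromorphicQuotient D) : derivFun (c • x) = c • derivFun x := by
  obtain ⟨f, hf, rfl⟩ := exists_mk_eq x
  rw [derivFun_mk, Algebra.smul_def, Algebra.smul_def, mk_algebraMap, mk_mul, mk_mul, derivFun_mk,
    mk_eq_iff]
  filter_upwards [hf.eventually_codiscreteWithin_analyticAt] with y h1
  exact deriv_const_mul c h1.differentiableAt

/-- Differentiation as a derivation of the algebra of meromorphic functions. -/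
noncomputable def derivation (D : Set ℂ) :
    Derivation ℂ (MeromorphicQuotient D) (MeromorphicQuotient D) where
  toFun := derivFun
  map_add' := derivFun_add
  map_smul' := derivFun_smul
  map_one_eq_zero' := by
    have h := derivFun_mul (1 : MeromorphicQuotient D) 1
    rw [one_mul, one_mul] at h
    simpa using h
  leibniz' := derivFun_mul

theorem derivation_mk (hf : MeromorphicOn f D) :
    derivation D (mk f hf) = mk (deriv f) hf.deriv := derivFun_mk hf

section Field

variable [hconn : Fact (IsConnected D)] [hopen : Fact (IsOpen D)]

noncomputable instance : Field (MeromorphicQuotient D) where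
  __ := (inferInstance : CommRing (MeromorphicQuotient D))
  __ := (isField hconn.out hopen.out).toField

theorem mk_inv (hf : MeromorphicOn f D) : (mk f hf)⁻¹ = mk f⁻¹ hf.inv := by
  by_cases h : mk f hf = 0
  · rw [h, inv_zero]
    rw [zero_eq_mk, mk_eq_iff] at h ⊢
    filter_upwards [h] with y hy
    simp [hy]
  · exact inv_eq_of_mul_eq_one_right (mk_mul_inv hconn.out hopen.out h)

theorem mk_div (hf : MeromorphicOn f D) (hg : MeromorphicOn g D) :
    mk f hf / mk g hg = mk (f / g) (hf.div hg) := by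
  rw [div_eq_mul_inv, mk_inv, mk_mul, mk_eq_iff, div_eq_mul_inv]

end Field
end MeromorphicQuotient
end MeromorphicField


/-! ### Translation between functions and their classes. -/

namespace MeromorphicQuotient

section Bridge

variable {D : Set ℂ} {G T : ℂ → ℂ}

theorem two_eq_mk : (2 : MeromorphicQuotient D) = mk (fun _ => 2) (MeromorphicOn.const 2) := by
  rw [← mk_algebraMap, map_ofNat]

theorem intCast_eq_mk (n : ℤ) :
    (n : MeromorphicQuotient D) = mk (fun _ => (n : ℂ)) (MeromorphicOn.const _) := by
  rw [← mk_algebraMap, map_intCast]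

/-- The class of the independent variable. -/
noncomputable def variableClass (D : Set ℂ) : MeromorphicQuotient D := mk id MeromorphicOn.id

theorem derivation_variableClass : derivation D (variableClass D) = 1 := by
  rw [variableClass, derivation_mk, one_eq_mk, mk_eq_iff]
  exact Eventually.of_forall fun y => deriv_id y

variable [hconn : Fact (IsConnected D)] [hopen : Fact (IsOpen D)]

theorem variableClass_ne_zero (h0 : (0 : ℂ) ∉ D) : variableClass D ≠ 0 := by
  rw [variableClass, mk_ne_zero_iff hconn.out hopen.out]
  filter_upwards [self_mem_codiscreteWithin D] with y hy h
  exact h0 ((show y = 0 from h) ▸ hy)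

theorem isPainleveVPair_iff {τ ρ : ℝ} {n m : ℤ} (hG : MeromorphicOn G D) (hT : MeromorphicOn T D) :
    IsPainleveVPair τ ρ D n m G T ↔
      IsAlgebraicPairAt (derivation D) (variableClass D) τ ρ n m (mk G hG) (mk T hT) := by
  have e1 : mk G hG ≠ 0 ↔ ∀ᶠ y in codiscreteWithin D, G y ≠ 0 :=
    mk_ne_zero_iff hconn.out hopen.out
  have e2 : mk G hG ≠ 1 ↔ ∀ᶠ y in codiscreteWithin D, G y ≠ 1 := by
    rw [← sub_ne_zero, one_eq_mk, mk_sub, mk_ne_zero_iff hconn.out hopen.out]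
    simp only [Pi.sub_apply, sub_ne_zero]
  have e3 : mk T hT ≠ 0 ↔ ∀ᶠ y in codiscreteWithin D, T y ≠ 0 :=
    mk_ne_zero_iff hconn.out hopen.out
  have e4 : (IsAlgebraicPairAt (derivation D) (variableClass D) τ ρ n m (mk G hG) (mk T hT)) ↔
      mk G hG ≠ 0 ∧ mk G hG ≠ 1 ∧ mk T hT ≠ 0 ∧ _ ∧ _ :=
    ⟨fun h => ⟨h.1, h.2, h.3, h.4, h.5⟩, fun h => ⟨h.1, h.2.1, h.2.2.1, h.2.2.2.1, h.2.2.2.2⟩⟩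
  rw [e4, e1, e2, e3]
  simp only [variableClass, derivation_mk, mk_algebraMap, one_eq_mk, two_eq_mk, intCast_eq_mk,
    mk_neg, mk_pow, mk_add, mk_sub, mk_mul, mk_div, mk_eq_iff, EventuallyEq, ← eventually_and]
  simp only [IsPainleveVPair, IsPainleveVSolution, IsQuadrature, hG, hT, true_and,
    ← eventually_and]
  apply eventually_congr
  refine Eventually.of_forall fun y => ?_
  simp only [Pi.add_apply, Pi.sub_apply, Pi.mul_apply, Pi.div_apply, Pi.neg_apply, Pi.pow_apply,
    id]
  tauto

/-- A polynomial relation between the classes of `y, G, G'` is a first-order algebraic equation for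
`G`, so the classes are algebraically independent and cannot lie in a field with two generators. -/
theorem not_subset_adjoin (h : NoFirstOrderAlgebraicODE D G) (hG : MeromorphicOn G D)
    (e : MeromorphicQuotient D) :
    ¬ {variableClass D, mk G hG, derivation D (mk G hG)} ⊆
      (adjoin ℂ {variableClass D, e} : Set (MeromorphicQuotient D)) := by
  have hx : AlgebraicIndependent ℂ
      ![variableClass D, mk G hG, derivation D (mk G hG)] := by
    rw [algebraicIndependent_iff]
    intro P hP
    apply h
    rw [derivation_mk] at hP
    let x : Fin 3 → meromorphicSubalgebra D :=
      ![⟨id, MeromorphicOn.id⟩, ⟨G, hG⟩, ⟨deriv G, hG.deriv⟩]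
    have h1 : ![variableClass D, mk G hG, mk (deriv G) hG.deriv] = fun i => mkₐ D (x i) := by
      funext i
      fin_cases i <;> rfl
    have h2 : MvPolynomial.aeval (fun i => mkₐ D (x i)) P
        = mk (MvPolynomial.aeval x P : meromorphicSubalgebra D).1
          (MvPolynomial.aeval x P : meromorphicSubalgebra D).2 := by
      have := MvPolynomial.comp_aeval_apply x (mkₐ D) P
      exact this.symm
    rw [h1, h2, zero_eq_mk] at hP
    have hmem : MeromorphicOn (MvPolynomial.aeval x P : meromorphicSubalgebra D).1 D :=
      (MvPolynomial.aeval x P : meromorphicSubalgebra D).2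
    filter_upwards [(mk_eq_iff (hf := hmem) (hg := MeromorphicOn.const 0)).1 hP] with y hy
    rw [← hy]
    have h3 := MvPolynomial.comp_aeval_apply x
      ((Pi.evalAlgHom ℂ (fun _ : ℂ => ℂ) y).comp (meromorphicSubalgebra D).val) P
    refine Eq.trans ?_ h3.symm
    rw [← MvPolynomial.coe_aeval_eq_eval]
    have h4 : ![y, G y, deriv G y] = fun i =>
        ((Pi.evalAlgHom ℂ (fun _ : ℂ => ℂ) y).comp (meromorphicSubalgebra D).val) (x i) := by
      funext i
      fin_cases i <;> rfl
    rw [h4]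
    rfl
  have h2 := hx.not_subset_adjoin_pair (variableClass D) e
  simpa only [Matrix.range_cons, Matrix.range_empty, Set.union_empty, Set.singleton_union] using h2

/-- Nearest neighbours carry opposite exponents and opposite corners equal ones, so in each product
the exponentials cancel. -/
theorem isContinuouslyInvariantH1Solution {τ : ℝ} {T : ℤ → ℤ → ℂ → ℂ}
    (hT : ∀ n m, MeromorphicOn (T n m) D)
    (h : IsAlgebraicLatticeSolution (derivation D) (variableClass D) τ
      fun n m => mk (T n m) (hT n m)) :
    IsContinuouslyInvariantH1Solution (similarityForm τ T) D := by
  intro n m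
  have h1 := h.h1 n m
  have h2 := h.invariant_fst n m
  have h3 := h.invariant_snd n m
  simp only [variableClass, derivation_mk, mk_algebraMap, intCast_eq_mk, zero_eq_mk,
    mk_add, mk_sub, mk_mul, mk_eq_iff] at h1 h2 h3
  filter_upwards [h1, h2, h3, (hT n m).eventually_codiscreteWithin_analyticAt] with y h1 h2 h3 h4
  rintro α β rfl
  simp only [Pi.add_apply, Pi.sub_apply, Pi.mul_apply, id] at h1 h2 h3
  set μ := signedTau τ n m with hμ
  have hd1 : HasDerivAt (fun a => similarityForm τ T n m a β)
      ((deriv (T n m) (α - β) + μ * T n m (α - β)) * Complex.exp (μ * (α + β))) α := by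
    have e1 : HasDerivAt (fun a => T n m (a - β)) (deriv (T n m) (α - β)) α :=
      h4.differentiableAt.hasDerivAt.comp_sub_const α β
    have e2 : HasDerivAt (fun a => Complex.exp (μ * (a + β)))
        (Complex.exp (μ * (α + β)) * (μ * 1)) α :=
      (((hasDerivAt_id α).add_const β).const_mul μ).cexp
    exact (e1.mul e2).congr_deriv (by ring)
  have hd2 : HasDerivAt (fun b => similarityForm τ T n m α b)
      ((μ * T n m (α - β) - deriv (T n m) (α - β)) * Complex.exp (μ * (α + β))) β := by
    have e1 : HasDerivAt (fun b => T n m (α - b)) (-deriv (T n m) (α - β)) β :=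
      h4.differentiableAt.hasDerivAt.comp_const_sub α β
    have e2 : HasDerivAt (fun b => Complex.exp (μ * (α + b)))
        (Complex.exp (μ * (α + β)) * (μ * 1)) β :=
      (((hasDerivAt_id β).const_add α).const_mul μ).cexp
    exact (e1.mul e2).congr_deriv (by ring)
  have s1 : signedTau τ (n + 1) m = -μ := signedTau_succ_fst τ n m
  have s2 : signedTau τ n (m + 1) = -μ := signedTau_succ_snd τ n m
  have s3 : signedTau τ (n + 1) (m + 1) = μ := by
    rw [signedTau_succ_fst, signedTau_succ_snd, neg_neg]
  have s4 : signedTau τ (n - 1) m = -μ := by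
    rw [hμ, ← sub_add_cancel n 1, signedTau_succ_fst, neg_neg, sub_add_cancel]
  have s5 : signedTau τ n (m - 1) = -μ := by
    rw [hμ, ← sub_add_cancel m 1, signedTau_succ_snd, neg_neg, sub_add_cancel]
  have hexp : Complex.exp (-μ * (α + β)) * Complex.exp (μ * (α + β)) = 1 := by
    rw [← Complex.exp_add, neg_mul, neg_add_cancel, Complex.exp_zero]
  refine ⟨?_, hd1.differentiableAt, hd2.differentiableAt, ?_, ?_⟩
  · simp only [similarityForm, s1, s2, s3, ← hμ]
    linear_combination h1 + (T n m (α - β) - T (n + 1) (m + 1) (α - β)) *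
      (T (n + 1) m (α - β) - T n (m + 1) (α - β)) * hexp
  · rw [hd1.deriv]
    simp only [similarityForm, s1, s4]
    linear_combination h2 + (T (n + 1) m (α - β) - T (n - 1) m (α - β)) *
      (deriv (T n m) (α - β) + μ * T n m (α - β)) * hexp
  · rw [hd2.deriv]
    simp only [similarityForm, s2, s5]
    linear_combination h3 + (T n (m + 1) (α - β) - T n (m - 1) (α - β)) *
      (μ * T n m (α - β) - deriv (T n m) (α - β)) * hexp

/-- Choice of meromorphic representatives for a lattice solution, with prescribed representatives
at one lattice point. -/
theorem exists_representatives {τ ρ : ℝ} {n₀ m₀ : ℤ} {G₀ T₀ : ℂ → ℂ}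
    (hseed : IsPainleveVPair τ ρ D n₀ m₀ G₀ T₀) {x : ℤ → ℤ → MeromorphicQuotient D}
    {p : ℤ → ℤ → Prop} (hx₀ : x n₀ m₀ = mk T₀ hseed.2.1)
    (hx : IsAlgebraicLatticeSolution (derivation D) (variableClass D) τ x)
    (hp : ∀ n m, p n m → ∃ g,
      IsAlgebraicPairAt (derivation D) (variableClass D) τ ρ n m g (x n m)) :
    ∃ G T : ℤ → ℤ → ℂ → ℂ, G n₀ m₀ = G₀ ∧ T n₀ m₀ = T₀ ∧ (∀ n m : ℤ, MeromorphicOn (T n m) D) ∧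
      IsContinuouslyInvariantH1Solution (similarityForm τ T) D ∧
      ∀ n m : ℤ, p n m → IsPainleveVPair τ ρ D n m (G n m) (T n m) := by
  have key : ∀ n m : ℤ, ∃ G T : ℂ → ℂ, (n = n₀ ∧ m = m₀ → G = G₀ ∧ T = T₀) ∧
      (∃ hT : MeromorphicOn T D, mk T hT = x n m) ∧
      (p n m → IsPainleveVPair τ ρ D n m G T) := by
    intro n m
    by_cases h : n = n₀ ∧ m = m₀
    · obtain ⟨rfl, rfl⟩ := h
      exact ⟨G₀, T₀, fun _ => ⟨rfl, rfl⟩, ⟨hseed.2.1, hx₀.symm⟩, fun _ => hseed⟩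
    · obtain ⟨T, hT, hTx⟩ := exists_mk_eq (x n m)
      by_cases hpn : p n m
      · obtain ⟨g, hg⟩ := hp n m hpn
        obtain ⟨G, hG, rfl⟩ := exists_mk_eq g
        rw [← hTx] at hg
        exact ⟨G, T, fun h' => absurd h' h, ⟨hT, hTx⟩,
          fun _ => (isPainleveVPair_iff hG hT).2 hg⟩
      · exact ⟨G₀, T, fun h' => absurd h' h, ⟨hT, hTx⟩, fun h' => absurd h' hpn⟩
  choose G T h1 h2 h3 using key
  choose hT hTx using h2
  refine ⟨G, T, (h1 n₀ m₀ ⟨rfl, rfl⟩).1, (h1 n₀ m₀ ⟨rfl, rfl⟩).2, hT, ?_, h3⟩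
  apply isContinuouslyInvariantH1Solution hT
  simpa only [hTx] using hx

end Bridge
end MeromorphicQuotient

/-! ### The theorem for meromorphic functions. -/

theorem mainTheorem5 (τ ρ : ℝ) (hτ : τ ≠ 0) (D : Set ℂ) (hD : IsOpen D)
    (hconn : IsPreconnected D) (h0 : (0 : ℂ) ∉ D) (n₀ m₀ : ℤ) (G₀ T₀ : ℂ → ℂ)
    (hseed : IsPainleveVPair τ ρ D n₀ m₀ G₀ T₀) :
    (NoFirstOrderAlgebraicODE D G₀ →
      ∃ G T : ℤ → ℤ → ℂ → ℂ, G n₀ m₀ = G₀ ∧ T n₀ m₀ = T₀ ∧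
        (∀ n m : ℤ, MeromorphicOn (T n m) D) ∧
        IsContinuouslyInvariantH1Solution (similarityForm τ T) D ∧
        ∀ n m : ℤ, IsPainleveVPair τ ρ D n m (G n m) (T n m)) ∧
    ((∀ k : ℤ, ρ ≠ (2 * (k : ℝ) + 1) * τ) →
      ∃ G T : ℤ → ℤ → ℂ → ℂ, G n₀ m₀ = G₀ ∧ T n₀ m₀ = T₀ ∧
        (∀ n m : ℤ, MeromorphicOn (T n m) D) ∧
        IsContinuouslyInvariantH1Solution (similarityForm τ T) D ∧
        ∀ n m : ℤ, (n = 0 → n₀ = 0) → (m = 0 → m₀ = 0) →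
          IsPainleveVPair τ ρ D n m (G n m) (T n m)) := by
  rcases D.eq_empty_or_nonempty with rfl | hne
  -- For empty `D` every eventual statement holds; the transcendence hypothesis then fails at the
  -- polynomial `1`, and constant families prove the second claim.
  · have hbot : codiscreteWithin (∅ : Set ℂ) = ⊥ := by simp [codiscreteWithin]
    refine ⟨fun h => absurd (h 1 (by simp [hbot])) one_ne_zero, fun _ =>
      ⟨fun _ _ => G₀, fun _ _ => T₀, rfl, rfl, fun _ _ => hseed.2.1, fun n m => by simp [hbot],
        fun n m _ _ => ⟨⟨hseed.1.1, by simp [hbot]⟩, ⟨hseed.2.1, by simp [hbot]⟩⟩⟩⟩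
  have : Fact (IsConnected D) := ⟨⟨hne, hconn⟩⟩
  have : Fact (IsOpen D) := ⟨hD⟩
  have hpair := (MeromorphicQuotient.isPainleveVPair_iff hseed.1.1 hseed.2.1).1 hseed
  have hy := MeromorphicQuotient.derivation_variableClass (D := D)
  have hy0 := MeromorphicQuotient.variableClass_ne_zero h0
  constructor
  · intro h
    obtain ⟨x, hx₀, hx, hp⟩ := hpair.exists_lattice_of_not_subset hτ hy hy0
      (MeromorphicQuotient.not_subset_adjoin h hseed.1.1)
    obtain ⟨G, T, hG, hT, hmer, hsol, hall⟩ := MeromorphicQuotient.exists_representatives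
      (p := fun _ _ => True) hseed hx₀ hx fun n m _ => hp n m
    exact ⟨G, T, hG, hT, hmer, hsol, fun n m => hall n m trivial⟩
  · intro hρ
    obtain ⟨x, hx₀, hx, hp⟩ := hpair.exists_lattice_of_ne hτ hy hy0 hρ
    obtain ⟨G, T, hG, hT, hmer, hsol, hall⟩ := MeromorphicQuotient.exists_representatives
      (p := fun n m => (n = 0 → n₀ = 0) ∧ (m = 0 → m₀ = 0)) hseed hx₀ hx
      fun n m h => hp n m h.1 h.2
    exact ⟨G, T, hG, hT, hmer, hsol, fun n m hn hm => hall n m ⟨hn, hm⟩⟩
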